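/- All manifolds are smooth, Hausdorff and second countable. A \emph{singular foliation} on a manifold $M$ is a subsheaf $\mathcal F\subseteq \mathfrak X_M$ of $\mathcal O_M$-modules of the sheaf of smooth vector fields which is stable under the Lie bracket and locally finitely generated: every point has an open neighborhood $\mathcal U$ with $X_1,\dots,X_r\in\mathfrak X(\mathcal U)$ whose restrictions generate $\mathcal F(\mathcal V)$ as a $C^\infty(\mathcal V)$-module for every open $\mathcal V\subseteq \mathcal U$. Two points lie in the same \emph{leaf} of $\mathcal F$ if they can be joined by a finite concatenation of integral curves, run in either direction, of local sections of $\mathcal F$. For a smooth map $\varphi\colon P\to M$, let $\varphi^*\mathcal F\subseteq\Gamma(\varphi^*TM)$ be the sheaf of $\mathcal O_P$-modules generated by the sections $X\circ\varphi$ with $X\in\mathcal F$, and put $\varphi^{-1}(\mathcal F)=\{Z\in\mathfrak X_P : T\varphi(Z)\in\varphi^*\mathcal F\}$. Let $(M,\mathcal F_M)$ and $(N,\mathcal F_N)$ be manifolds with singular foliations. A \emph{bi-submersion} $(M,\mathcal F_M)\stackrel{p}{\leftarrow}W\stackrel{q}{\rightarrow}(N,\mathcal F_N)$ is a manifold $W$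 (not necessarily connected, whose connected components may have different dimensions) with two submersions $p\colon W\to M$, $q\colon W\to N$ such that $$p^{-1}(\mathcal F_M)=q^{-1}(\mathcal F_N)=\Gamma(\ker Tp)+\Gamma(\ker Tq).$$ Its \emph{bi-vertical} vector fields are the sections of $\mathcal{BV}_W=\Gamma(\ker Tp)\cap\Gamma(\ker Tq)$. Two points $w,w'\in W$ are \emph{equivalent} if there are open neighborhoods $\mathcal U_w\ni w$ and $\mathcal U_{w'}\ni w'$ in $W$, a manifold $V$ with surjective submersions $\delta\colon V\to\mathcal U_w$ and $\eta\colon V\to\mathcal U_{w'}$ satisfying $p\circ\delta=p\circ\eta$ and $q\circ\delta=q\circ\eta$, and a point $v\in V$ with $\delta(v)=w$ and $\eta(v)=w'$. \textbf{Theorem.} Let $(M,\mathcal F_M)\stackrel{p}{\leftarrow}W\stackrel{q}{\rightarrow}(N,\mathcal F_N)$ be a bi-submersion such that $\mathcal{BV}_W$ is a singular foliation on $W$. Then every point $x\in W$ has an open neighborhood $\mathcal U$ such that, for any two points $w,w'\in\mathcal U$, the following are equivalent: (i) $w$ and $w'$ are equivalent; (ii) $w$ and $w'$ lie in the same leaf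 of the bi-vertical singular foliation $\mathcal{BV}_W$ of $W$. -/

import Mathlib

open scoped Manifold ContDiff Topology
open TopologicalSpace (Opens)

universe u

/-- (Not necessarily smooth) vector fields on an `n`-dimensional manifold. A vector field on an
open set `U` is represented by such a function, whose values outside `U` are irrelevant. -/
abbrev VField (n : ℕ) (M : Type*) [TopologicalSpace M]
    [ChartedSpace (EuclideanSpace ℝ (Fin n)) M] : Type _ :=
  (x : M) → TangentSpace (𝓡 n) x

section Foliations

variable {n : ℕ} {M : Type*} [TopologicalSpace M] [ChartedSpace (EuclideanSpace ℝ (Fin n)) M]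

/-- The vector field `X` is smooth on the open set `U`. -/
def VField.SmoothOn [IsManifold (𝓡 n) ∞ M] (X : VField n M) (U : Opens M) : Prop :=
  ContMDiffOn (𝓡 n) (𝓡 n).tangent ∞ (fun x => (⟨x, X x⟩ : TangentBundle (𝓡 n) M)) U

/-- The real function `f` is smooth on the open set `U` (values outside `U` are irrelevant). -/
def FunSmoothOn (n : ℕ) {M : Type*} [TopologicalSpace M]
    [ChartedSpace (EuclideanSpace ℝ (Fin n)) M] (f : M → ℝ) (U : Opens M) : Prop :=
  ContMDiffOn (𝓡 n) 𝓘(ℝ, ℝ) ∞ f U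

/-- `F` is a subsheaf of modules (over smooth functions) of the sheaf of smooth vector fields;
`F U` is the set of sections over the open set `U`. -/
structure IsVFieldSubsheaf [IsManifold (𝓡 n) ∞ M] (F : Opens M → Set (VField n M)) : Prop where
  smooth : ∀ U, ∀ X ∈ F U, X.SmoothOn U
  congr : ∀ U, ∀ X ∈ F U, ∀ Y : VField n M, (∀ x ∈ U, Y x = X x) → Y ∈ F U
  zero_mem : ∀ U, (0 : VField n M) ∈ F U
  add_mem : ∀ U, ∀ X ∈ F U, ∀ Y ∈ F U, X + Y ∈ F U
  smul_mem : ∀ U, ∀ f : M → ℝ, FunSmoothOn n f U → ∀ X ∈ F U, (fun x => f x • X x) ∈ F U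
  restrict : ∀ U V : Opens M, V ≤ U → ∀ X ∈ F U, X ∈ F V
  glue : ∀ (U : Opens M) (X : VField n M), (∀ x ∈ U, ∃ V ≤ U, x ∈ V ∧ X ∈ F V) → X ∈ F U

/-- Singular foliations: subsheaves of modules of vector fields that are stable under the Lie
bracket and locally finitely generated. -/
structure IsSingularFoliation [IsManifold (𝓡 n) ∞ M] (F : Opens M → Set (VField n M)) : Prop
    extends IsVFieldSubsheaf F where
  bracket_mem : ∀ U, ∀ X ∈ F U, ∀ Y ∈ F U, VectorField.mlieBracket (𝓡 n) X Y ∈ F U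
  locally_finitely_generated : ∀ x : M, ∃ U : Opens M, x ∈ U ∧
    ∃ (r : ℕ) (X : Fin r → VField n M), (∀ i, (X i).SmoothOn U) ∧
      ∀ V ≤ U, ∀ Y : VField n M, Y ∈ F V ↔
        ∃ f : Fin r → M → ℝ, (∀ i, FunSmoothOn n (f i) V) ∧
          ∀ y ∈ V, Y y = ∑ i, f i y • X i y

/-- One can go from `x` to `y` along an integral curve of a local section of `F`. -/
def LeafStep (F : Opens M → Set (VField n M)) (x y : M) : Prop :=
  ∃ (U : Opens M) (X : VField n M) (γ : ℝ → M) (T : ℝ),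
    X ∈ F U ∧ 0 ≤ T ∧ γ 0 = x ∧ γ T = y ∧ (∀ t ∈ Set.Icc 0 T, γ t ∈ U) ∧
      IsMIntegralCurveOn (I := 𝓡 n) γ X (Set.Icc 0 T)

/-- `x` and `y` lie in the same leaf of `F`: they are joined by finitely many pieces of integral
curves of local sections of `F`, run in either direction. -/
def SameLeaf (F : Opens M → Set (VField n M)) : M → M → Prop :=
  Relation.EqvGen (LeafStep F)

end Foliations

section BiSubmersions

variable {d m n : ℕ}
  {W : Type*} [TopologicalSpace W] [ChartedSpace (EuclideanSpace ℝ (Fin d)) W]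
  [IsManifold (𝓡 d) ∞ W]
  {M : Type*} [TopologicalSpace M] [ChartedSpace (EuclideanSpace ℝ (Fin m)) M]
  [IsManifold (𝓡 m) ∞ M]
  {N : Type*} [TopologicalSpace N] [ChartedSpace (EuclideanSpace ℝ (Fin n)) N]
  [IsManifold (𝓡 n) ∞ N]

/-- The sheaf `Γ(ker Tp)` of smooth vector fields that are tangent to the fibres of `p`. -/
def verticalFields (p : W → M) (U : Opens W) : Set (VField d W) :=
  {Z | Z.SmoothOn U ∧ ∀ y ∈ U, mfderiv (𝓡 d) (𝓡 m) p y (Z y) = 0}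

/-- The pull-back `p⁻¹(F)`: smooth vector fields `Z` such that `Tp(Z)`, as a section of `p^*TM`,
is locally a combination, with smooth functions on `W` as coefficients, of sections `X ∘ p`
with `X` in `F`. -/
def pullbackFields (p : W → M) (F : Opens M → Set (VField m M)) (U : Opens W) :
    Set (VField d W) :=
  {Z | Z.SmoothOn U ∧ ∀ x ∈ U, ∃ V ≤ U, x ∈ V ∧
    ∃ O : Opens M, (∀ y ∈ V, p y ∈ O) ∧
    ∃ (r : ℕ) (X : Fin r → VField m M) (f : Fin r → W → ℝ),
      (∀ i, X i ∈ F O) ∧ (∀ i, FunSmoothOn d (f i) V) ∧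
        ∀ y ∈ V, mfderiv (𝓡 d) (𝓡 m) p y (Z y) = ∑ i, f i y • X i (p y)}

/-- The sum `Γ(ker Tp) + Γ(ker Tq)`. -/
def verticalSumFields (p : W → M) (q : W → N) (U : Opens W) : Set (VField d W) :=
  {Z | ∃ ξ ∈ verticalFields (m := m) p U, ∃ ζ ∈ verticalFields (m := n) q U,
    ∀ y ∈ U, Z y = ξ y + ζ y}

/-- The sheaf `Γ(ker Tp) ∩ Γ(ker Tq)` of bi-vertical vector fields. -/
def biVerticalFields (p : W → M) (q : W → N) (U : Opens W) : Set (VField d W) :=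
  verticalFields (m := m) p U ∩ verticalFields (m := n) q U

/-- `p : W → M` and `q : W → N` form a bi-submersion between `(M, FM)` and `(N, FN)`. -/
structure IsBiSubmersion (FM : Opens M → Set (VField m M)) (FN : Opens N → Set (VField n N))
    (p : W → M) (q : W → N) : Prop where
  submersion_left : Manifold.IsSubmersion (𝓡 d) (𝓡 m) ∞ p
  submersion_right : Manifold.IsSubmersion (𝓡 d) (𝓡 n) ∞ q
  pullback_eq : (pullbackFields p FM : Opens W → Set (VField d W)) = pullbackFields q FN
  pullback_eq_sum : (pullbackFields p FM : Opens W → Set (VField d W)) =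
    verticalSumFields (m := m) (n := n) p q

end BiSubmersions

section Equivalence

variable {k d d' : ℕ}
  {W : Type u} [TopologicalSpace W] [ChartedSpace (EuclideanSpace ℝ (Fin d)) W]
  {W' : Type u} [TopologicalSpace W'] [ChartedSpace (EuclideanSpace ℝ (Fin d')) W']
  {V : Type u} [TopologicalSpace V] [ChartedSpace (EuclideanSpace ℝ (Fin k)) V]
  {M N : Type*}

/-- `(V, δ, η)` is a relation between the restriction of `(W, p, q)` to the open set `U` and the
restriction of `(W', p', q')` to the open set `U'`: `δ : V → U` and `η : V → U'` are surjective
submersions that intertwine the maps to `M` and `N`. -/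
structure IsRelation (p : W → M) (q : W → N) (p' : W' → M) (q' : W' → N)
    (U : Opens W) (U' : Opens W') (δ : V → W) (η : V → W') : Prop where
  submersion_left : Manifold.IsSubmersion (𝓡 k) (𝓡 d) ∞ δ
  submersion_right : Manifold.IsSubmersion (𝓡 k) (𝓡 d') ∞ η
  range_left : Set.range δ = U
  range_right : Set.range η = U'
  comm_left : ∀ v, p (δ v) = p' (η v)
  comm_right : ∀ v, q (δ v) = q' (η v)

/-- The points `w` of `(W, p, q)` and `w'` of `(W', p', q')` are equivalent: they are related
through a relation between an open neighbourhood of `w` and an open neighbourhood of `w'`. -/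
def EquivalentPoints (p : W → M) (q : W → N) (p' : W' → M) (q' : W' → N)
    (w : W) (w' : W') : Prop :=
  ∃ (U : Opens W) (U' : Opens W') (k : ℕ) (V : Type u) (_ : TopologicalSpace V)
    (_ : ChartedSpace (EuclideanSpace ℝ (Fin k)) V) (_ : IsManifold (𝓡 k) ∞ V)
    (_ : T2Space V) (_ : SecondCountableTopology V) (δ : V → W) (η : V → W'),
    w ∈ U ∧ w' ∈ U' ∧ IsRelation (k := k) (d := d) (d' := d') p q p' q' U U' δ η ∧
      ∃ v, δ v = w ∧ η v = w'

end Equivalence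

/-! From leaves to equivalence, the flow of a bi-vertical field consists of local diffeomorphisms
preserving `p` and `q`, since its orbits stay in the fibres of both. Such germs compose and invert,
and connectedness of the time interval carries them along whole integral curves
(`locallyRelated_of_sameLeaf`). The graph of such a germ is a relation
(`LocallyRelated.equivalentPoints`). This direction needs no small neighbourhood.

Conversely, composing `η` with a local section of `δ` turns a relation into a germ `g` of smooth map
with `g w = w'` preserving `p` and `q` (`EquivalentPoints.exists_germ`). The bi-submersion
identities provide, near `x`, a frame `ξ` of `ker Tp` made of fields that are `q`-related to fields
`X` on `N` (`IsBiSubmersion.exists_projectable_frame`). As `z` and `g z` lie in the same fibre of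
`p`, the time-one flow of `ξ(·) k` takes `z` to `g z` for a suitable small `k = l z`, depending
smoothly on `z`. The image of this orbit under `q` is a closed orbit of `X(·) (l z)` of period one.
A field with Lipschitz constant less than one has only constant orbits of period one
(`eq_zero_of_closed_orbit`), so `X (q z) (l z) = 0` and the orbit remains in a fibre of `q`
(`exists_curve_of_germ`).

The field `ξ(·) (l w)` itself need not be bi-vertical off the fibre of `q` through `w`. With `μ = l
∘ τ` for a local section `τ` of `q` through `w`, the field `ξ(·) (μ ∘ q)` is bi-vertical near the
whole orbit and agrees with `ξ(·) (l w)` along it. Hence `w` and `w'` are joined by one integral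
curve of a bi-vertical field (`IsBiSubmersion.exists_nhds_leafStep`). -/

/-- Inverse function theorem for maps that are smooth near a point. -/
theorem exists_openPartialHomeomorph_of_smooth {E F : Type*}
    [NormedAddCommGroup E] [NormedSpace ℝ E] [CompleteSpace E]
    [NormedAddCommGroup F] [NormedSpace ℝ F] {f : E → F} {a : E} {f' : E ≃L[ℝ] F}
    (hf : ∀ᶠ y in 𝓝 a, ContDiffAt ℝ ∞ f y) (hf' : HasFDerivAt f (f' : E →L[ℝ] F) a) :
    ∃ e : OpenPartialHomeomorph E F, a ∈ e.source ∧ (∀ x, e x = f x) ∧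
      ∀ y ∈ e.target, ContDiffAt ℝ ∞ e.symm y := by
  have hfa := hf.self_of_nhds
  have h1 : ∀ᶠ y in 𝓝 a, fderiv ℝ f y ∈ Set.range ((↑) : (E ≃L[ℝ] F) → E →L[ℝ] F) := by
    have hc : ContinuousAt (fderiv ℝ f) a :=
      (hfa.fderiv_right (m := 0) (by simp)).continuousAt
    apply hc
    rw [hf'.fderiv]
    exact ContinuousLinearEquiv.nhds f'
  obtain ⟨O, hO, hOo, haO⟩ := eventually_nhds_iff.1 (hf.and h1)
  set e₀ := hfa.toOpenPartialHomeomorph f hf' (by simp)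
  have ha₀ : a ∈ e₀.source := hfa.mem_toOpenPartialHomeomorph_source hf' (by simp)
  -- Restricting to points where `f` is smooth with invertible derivative makes the inverse smooth
  -- on the whole target, not only at the image of `a`.
  refine ⟨e₀.restrOpen O hOo, ⟨ha₀, haO⟩, fun x => rfl, fun y hy => ?_⟩
  have hy' := (e₀.restrOpen O hOo).map_target hy
  obtain ⟨h2, g, hg⟩ := hO _ hy'.2
  refine (e₀.restrOpen O hOo).contDiffAt_symm (f₀' := g) hy ?_ h2
  rw [hg]
  exact (h2.differentiableAt (by simp)).hasFDerivAt

/-! ### Superposition operators on spaces of continuous curves -/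

section CompositionOperator

variable {K : Type*} [TopologicalSpace K] [CompactSpace K]

/-- Pointwise application of a bilinear map to two continuous families of vectors. -/
noncomputable def pointwiseCLM (K : Type*) [TopologicalSpace K] [CompactSpace K] {G E F : Type*}
    [NormedAddCommGroup G] [NormedSpace ℝ G]
    [NormedAddCommGroup E] [NormedSpace ℝ E] [NormedAddCommGroup F] [NormedSpace ℝ F]
    (B : G →L[ℝ] E →L[ℝ] F) : C(K, G) →L[ℝ] C(K, E) →L[ℝ] C(K, F) :=
  LinearMap.mkContinuous₂
    (LinearMap.mk₂ ℝ (fun (A : C(K, G)) (h : C(K, E)) =>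
      (⟨fun s => B (A s) (h s), by fun_prop⟩ : C(K, F)))
      (fun A B h => by ext; simp) (fun c A h => by ext; simp)
      (fun A h k => by ext; simp) (fun c A h => by ext; simp)) ‖B‖ (fun A h => by
      rw [ContinuousMap.norm_le _ (by positivity)]
      intro s
      simp only [LinearMap.mk₂_apply, ContinuousMap.coe_mk]
      exact B.le_of_opNorm₂_le_of_le le_rfl (A.norm_coe_le_norm s) (h.norm_coe_le_norm s))

/-- The operator `γ ↦ f ∘ γ` on continuous curves. -/
def superposition {E F : Type*} [TopologicalSpace E] [TopologicalSpace F]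
    (f : E → F) (hf : Continuous f) (γ : C(K, E)) : C(K, F) :=
  ⟨fun s => f (γ s), hf.comp γ.continuous⟩

theorem contDiff_pointwiseCLM {G E F : Type*} [NormedAddCommGroup G] [NormedSpace ℝ G]
    [NormedAddCommGroup E] [NormedSpace ℝ E] [NormedAddCommGroup F] [NormedSpace ℝ F]
    (B : G →L[ℝ] E →L[ℝ] F) : ContDiff ℝ ∞ (fun A : C(K, G) => pointwiseCLM K B A) :=
  ContinuousLinearMap.contDiff _

/-- The image of `γ` is compact, so the derivative of `f` varies by at most `ε` on balls of one
common radius around its points. The mean value inequality then bounds the remainder uniformly in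
`s`. -/
theorem hasFDerivAt_superposition {G E F : Type*} [NormedAddCommGroup G] [NormedSpace ℝ G]
    [NormedAddCommGroup E] [NormedSpace ℝ E] [NormedAddCommGroup F] [NormedSpace ℝ F]
    (B : G →L[ℝ] E →L[ℝ] F) (f : E → F) (hfc : Continuous f) (f' : E → G) (hf'c : Continuous f')
    (hf : ∀ x, HasFDerivAt f (B (f' x)) x) (γ : C(K, E)) :
    HasFDerivAt (superposition f hfc) (pointwiseCLM K B (superposition f' hf'c γ)) γ := by
  rw [hasFDerivAt_iff_isLittleO_nhds_zero, Asymptotics.isLittleO_iff]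
  intro ε hε
  have huc := (isCompact_range γ.continuous).uniformContinuousAt_of_continuousAt
    (fun x => B (f' x)) (fun a _ => (B.continuous.comp hf'c).continuousAt)
    (Metric.dist_mem_uniformity hε)
  obtain ⟨δ, hδ, huc⟩ := Metric.mem_uniformity_dist.1 huc
  filter_upwards [Metric.ball_mem_nhds (0 : C(K, E)) hδ] with h hh
  rw [mem_ball_zero_iff] at hh
  rw [ContinuousMap.norm_le _ (by positivity)]
  intro s
  have hs : ‖h s‖ < δ := (h.norm_coe_le_norm s).trans_lt hh
  have key := (convex_ball (γ s) δ).norm_image_sub_le_of_norm_hasFDerivWithin_le'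
    (f := f) (f' := fun x => B (f' x)) (φ := B (f' (γ s))) (C := ε)
    (fun x _ => (hf x).hasFDerivWithinAt) (fun x hx => by
      have := huc (a := γ s) (b := x) (by rwa [dist_comm]) (Set.mem_range_self s)
      rw [← dist_eq_norm, dist_comm]
      exact le_of_lt this)
    (Metric.mem_ball_self hδ) (y := γ s + h s) (by simpa using hs)
  simp only [add_sub_cancel_left] at key
  refine key.trans ?_
  gcongr
  exact h.norm_coe_le_norm s

/-- Induction on the order of differentiability: the derivative is superposition with `fderiv ℝ f`
followed by a continuous linear map. The target is generalized because it becomes `E →L[ℝ] F`, and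
the common universe keeps that space within the scope of the induction. -/
theorem contDiff_superposition {E F : Type u}
    [NormedAddCommGroup E] [NormedSpace ℝ E] [NormedAddCommGroup F] [NormedSpace ℝ F]
    (f : E → F) (hf : ContDiff ℝ ∞ f) :
    ContDiff ℝ ∞ (superposition (K := K) f hf.continuous) := by
  rw [contDiff_infty]
  intro n
  induction n generalizing F with
  | zero => exact contDiff_zero.2 (ContinuousMap.continuous_postcomp ⟨f, hf.continuous⟩)
  | succ n ih =>
    have hf' : ContDiff ℝ ∞ (fderiv ℝ f) := (contDiff_infty_iff_fderiv.1 hf).2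
    have := hasFDerivAt_superposition (K := K) (ContinuousLinearMap.id ℝ (E →L[ℝ] F)) f
      hf.continuous (fderiv ℝ f) hf'.continuous
      (fun x => (hf.differentiable (by simp) x).hasFDerivAt)
    exact contDiff_succ_iff_hasFDerivAt.2 ⟨_, (ContinuousLinearMap.contDiff _).comp
      (ih (fderiv ℝ f) hf'), this⟩

end CompositionOperator

/-! ### Smooth dependence of local flows on parameters -/

section Flow

/-- Integration from `0` as an operator on continuous curves `[0, 1] → E`. -/
noncomputable def primitiveCLM (E : Type*) [NormedAddCommGroup E] [NormedSpace ℝ E] :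
    C(unitInterval, E) →L[ℝ] C(unitInterval, E) :=
  LinearMap.mkContinuous
    { toFun := fun γ => ⟨fun s => ∫ r in (0 : ℝ)..s, Set.IccExtend zero_le_one γ r,
        (intervalIntegral.continuous_primitive (fun a b =>
          (γ.continuous.Icc_extend').intervalIntegrable a b) 0).comp continuous_subtype_val⟩
      map_add' := fun γ δ => by
        ext s
        simp only [ContinuousMap.coe_mk, ContinuousMap.add_apply]
        rw [← intervalIntegral.integral_add ((γ.continuous.Icc_extend').intervalIntegrable _ _)
          ((δ.continuous.Icc_extend').intervalIntegrable _ _)]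
        rfl
      map_smul' := fun c γ => by
        ext s
        simp only [ContinuousMap.coe_mk, ContinuousMap.smul_apply, RingHom.id_apply]
        rw [← intervalIntegral.integral_smul]
        rfl } 1 (fun γ => by
    rw [ContinuousMap.norm_le _ (by positivity)]
    intro s
    have := intervalIntegral.norm_integral_le_of_norm_le_const (a := (0 : ℝ)) (b := s)
      (f := Set.IccExtend zero_le_one γ) (C := ‖γ‖) (fun r _ => γ.norm_coe_le_norm _)
    refine this.trans ?_
    rw [mul_comm]
    gcongr
    rw [sub_zero, abs_of_nonneg s.2.1]
    exact s.2.2)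

/-- Constant curves, as a continuous linear map. -/
noncomputable def constCLM (K : Type*) [TopologicalSpace K] [CompactSpace K] (E : Type*)
    [NormedAddCommGroup E] [NormedSpace ℝ E] : E →L[ℝ] C(K, E) :=
  LinearMap.mkContinuous
    { toFun := ContinuousMap.const K
      map_add' := fun _ _ => rfl
      map_smul' := fun _ _ => rfl } 1 (fun x => by
    rw [ContinuousMap.norm_le _ (by positivity)]
    intro s
    rw [one_mul]
    exact le_rfl)

/-- Smooth dependence of the solutions of `γ' = B (ξ γ) l`, `γ 0 = x` on `(l, x)`, in the space of
continuous curves, for a globally defined smooth family of vector fields. -/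
theorem exists_smooth_solution_curve {P E : Type u}
    [NormedAddCommGroup P] [NormedSpace ℝ P] [CompleteSpace P]
    [NormedAddCommGroup E] [NormedSpace ℝ E] [CompleteSpace E]
    {G : Type u} [NormedAddCommGroup G] [NormedSpace ℝ G] (B : G →L[ℝ] P →L[ℝ] E)
    (ξ : E → G) (hξ : ContDiff ℝ ∞ ξ) (x₀ : E) :
    ∃ Γ : P × E → C(unitInterval, E), (∀ᶠ y in 𝓝 (0, x₀), ContDiffAt ℝ ∞ Γ y) ∧
      Γ (0, x₀) = constCLM unitInterval E x₀ ∧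
      ∀ᶠ y in 𝓝 (0, x₀), Γ y = constCLM unitInterval E y.2 +
        primitiveCLM E (pointwiseCLM unitInterval B (superposition ξ hξ.continuous (Γ y))
          (constCLM unitInterval P y.1)) := by
  let I := unitInterval
  let T : (P × E) × C(I, E) → C(I, E) := fun z => constCLM I E z.1.2 +
    primitiveCLM E (pointwiseCLM I B (superposition ξ hξ.continuous z.2) (constCLM I P z.1.1))
  -- The integral equation is the vanishing of the second component. Keeping the data `z.1` as first
  -- component lets the inverse function theorem serve as an implicit function theorem.
  let Θ : (P × E) × C(I, E) → (P × E) × C(I, E) := fun z => (z.1, z.2 - T z)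
  let z₀ : (P × E) × C(I, E) := ((0, x₀), constCLM I E x₀)
  have hT : ContDiff ℝ ∞ T := by
    refine ContDiff.add ((constCLM I E ∘L ContinuousLinearMap.snd ℝ P E ∘L
      ContinuousLinearMap.fst ℝ (P × E) C(I, E)).contDiff) ?_
    refine (primitiveCLM E).contDiff.comp ?_
    exact ((contDiff_pointwiseCLM (K := I) B).comp ((contDiff_superposition ξ hξ).comp contDiff_snd)).clm_apply
      (constCLM I P ∘L ContinuousLinearMap.fst ℝ P E ∘L
        ContinuousLinearMap.fst ℝ (P × E) C(I, E)).contDiff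
  have hΘ : ContDiff ℝ ∞ Θ := contDiff_fst.prodMk (contDiff_snd.sub hT)
  -- At parameter `0` the integrand vanishes for every curve, so the derivative of `T` does not
  -- involve the variation of the curve. The derivative of `Θ` is therefore unipotent and has an
  -- explicit inverse.
  let A : P × E →L[ℝ] C(I, E) := constCLM I E ∘L ContinuousLinearMap.snd ℝ P E +
    primitiveCLM E ∘L (pointwiseCLM I B (superposition ξ hξ.continuous (constCLM I E x₀))) ∘L constCLM I P ∘L
      ContinuousLinearMap.fst ℝ P E
  have hT' : HasFDerivAt T (A ∘L ContinuousLinearMap.fst ℝ (P × E) C(I, E)) z₀ := by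
    have h1 : HasFDerivAt (fun z : (P × E) × C(I, E) => pointwiseCLM I B (superposition ξ hξ.continuous z.2))
        (fderiv ℝ (fun z : (P × E) × C(I, E) => pointwiseCLM I B (superposition ξ hξ.continuous z.2)) z₀) z₀ :=
      (((contDiff_pointwiseCLM (K := I) B).comp ((contDiff_superposition ξ hξ).comp
        contDiff_snd)).differentiable (by simp) z₀).hasFDerivAt
    have h2 : HasFDerivAt (fun z : (P × E) × C(I, E) => constCLM I P z.1.1)
        (constCLM I P ∘L ContinuousLinearMap.fst ℝ P E ∘L
          ContinuousLinearMap.fst ℝ (P × E) C(I, E)) z₀ :=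
      (constCLM I P ∘L ContinuousLinearMap.fst ℝ P E ∘L
          ContinuousLinearMap.fst ℝ (P × E) C(I, E)).hasFDerivAt
    have h3 := ((primitiveCLM E).hasFDerivAt.comp z₀ (h1.clm_apply h2))
    have h4 : HasFDerivAt (fun z : (P × E) × C(I, E) => constCLM I E z.1.2)
        (constCLM I E ∘L ContinuousLinearMap.snd ℝ P E ∘L
          ContinuousLinearMap.fst ℝ (P × E) C(I, E)) z₀ :=
      (constCLM I E ∘L ContinuousLinearMap.snd ℝ P E ∘L
          ContinuousLinearMap.fst ℝ (P × E) C(I, E)).hasFDerivAt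
    refine (h4.add h3).congr_fderiv ?_
    refine ContinuousLinearMap.ext fun z => ?_
    simp [A, z₀]
  let Θ' : ((P × E) × C(I, E)) ≃L[ℝ] ((P × E) × C(I, E)) :=
    ContinuousLinearEquiv.equivOfInverse
      ((ContinuousLinearMap.fst ℝ (P × E) C(I, E)).prod
        (ContinuousLinearMap.snd ℝ (P × E) C(I, E) -
          A ∘L ContinuousLinearMap.fst ℝ (P × E) C(I, E)))
      ((ContinuousLinearMap.fst ℝ (P × E) C(I, E)).prod
        (ContinuousLinearMap.snd ℝ (P × E) C(I, E) +
          A ∘L ContinuousLinearMap.fst ℝ (P × E) C(I, E)))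
      (fun z => by simp) (fun z => by simp)
  have hΘ' : HasFDerivAt Θ (Θ' : _ →L[ℝ] _) z₀ :=
    hasFDerivAt_fst.prodMk (hasFDerivAt_snd.sub hT')
  obtain ⟨e, he, hee, hes⟩ := exists_openPartialHomeomorph_of_smooth
    (Filter.Eventually.of_forall fun y => hΘ.contDiffAt) hΘ'
  have hΘz : Θ z₀ = ((0, x₀), 0) := by
    simp [Θ, T, z₀]
  have hmem : ((0, x₀), (0 : C(I, E))) ∈ e.target := by
    rw [← hΘz, ← hee]
    exact e.map_source he
  have hev : ∀ᶠ y : P × E in 𝓝 (0, x₀), (y, (0 : C(I, E))) ∈ e.target :=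
    (Continuous.prodMk_left (0 : C(I, E))).continuousAt.preimage_mem_nhds
      (e.open_target.mem_nhds hmem)
  refine ⟨fun y => (e.symm (y, 0)).2, ?_, ?_, ?_⟩
  · filter_upwards [hev] with y hy
    exact contDiffAt_snd.comp _ ((hes _ hy).comp y (contDiffAt_id.prodMk contDiffAt_const))
  · have : e.symm ((0, x₀), (0 : C(I, E))) = z₀ := by
      rw [← hΘz, ← hee]
      exact e.left_inv he
    simp only [this, z₀]
    rfl
  · filter_upwards [hev] with y hy
    have h1 : Θ (e.symm (y, 0)) = (y, 0) := by
      rw [← hee]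
      exact e.right_inv hy
    have h2 : (e.symm (y, 0)).1 = y := congrArg Prod.fst h1
    have h3 : (e.symm (y, 0)).2 - T (e.symm (y, 0)) = 0 := congrArg Prod.snd h1
    rw [sub_eq_zero] at h3
    conv_lhs => rw [h3]
    simp only [T, h2]
    rfl

end Flow

/-- A map that is smooth near a point coincides near that point with a globally smooth map. -/
theorem exists_contDiff_eventuallyEq {E F : Type*} [NormedAddCommGroup E] [NormedSpace ℝ E]
    [FiniteDimensional ℝ E] [NormedAddCommGroup F] [NormedSpace ℝ F] {f : E → F} {x₀ : E}
    (hf : ∀ᶠ y in 𝓝 x₀, ContDiffAt ℝ ∞ f y) :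
    ∃ g : E → F, ContDiff ℝ ∞ g ∧ g =ᶠ[𝓝 x₀] f := by
  obtain ⟨r, hr, hS⟩ := Metric.nhds_basis_closedBall.eventually_iff.1 hf
  let χ : ContDiffBump x₀ := ⟨r / 2, r, by positivity, by linarith⟩
  refine ⟨fun x => χ x • f x, contDiff_iff_contDiffAt.2 fun x => ?_, ?_⟩
  · by_cases hx : x ∈ Metric.closedBall x₀ r
    · exact χ.contDiffAt.smul (hS hx)
    · have : (fun x => χ x • f x) =ᶠ[𝓝 x] fun _ => 0 := by
        filter_upwards [Metric.isClosed_closedBall.isOpen_compl.mem_nhds hx] with y hy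
        rw [χ.zero_of_le_dist, zero_smul]
        exact le_of_lt (not_le.1 hy)
      exact contDiffAt_const.congr_of_eventuallyEq this
  · filter_upwards [χ.eventuallyEq_one] with y hy
    simp [hy]

/-- Local flows of a family of vector fields `ξ(·) l`, depending linearly on a parameter `l`,
depend smoothly on the parameter and on the initial point. -/
theorem exists_smooth_flow {P E : Type u}
    [NormedAddCommGroup P] [NormedSpace ℝ P] [CompleteSpace P]
    [NormedAddCommGroup E] [NormedSpace ℝ E] [FiniteDimensional ℝ E]
    {ξ : E → P →L[ℝ] E} {x₀ : E} (hξ : ∀ᶠ y in 𝓝 x₀, ContDiffAt ℝ ∞ ξ y) :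
    ∃ Γ : P × E → ℝ → E, (∀ᶠ y in 𝓝 (0, x₀), ContDiffAt ℝ ∞ (fun y => Γ y 1) y) ∧
      HasFDerivAt (fun y => Γ y 1)
        (ContinuousLinearMap.snd ℝ P E + ξ x₀ ∘L ContinuousLinearMap.fst ℝ P E) (0, x₀) ∧
      ∀ O ∈ 𝓝 x₀, ∀ᶠ y in 𝓝 ((0 : P), x₀), Γ y 0 = y.2 ∧
        ∀ s ∈ Set.Icc (0 : ℝ) 1, Γ y s ∈ O ∧ HasDerivAt (Γ y) (ξ (Γ y s) y.1) s := by
  have : CompleteSpace E := FiniteDimensional.complete ℝ E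
  obtain ⟨g, hg, hgξ⟩ := exists_contDiff_eventuallyEq hξ
  obtain ⟨C, hC, hC₀, hCe⟩ := exists_smooth_solution_curve
    (ContinuousLinearMap.id ℝ (P →L[ℝ] E)) g hg x₀
  have hge : ∀ y : P × E, Continuous (Set.IccExtend (zero_le_one (α := ℝ))
      (fun s => g (C y s) y.1)) := fun y =>
    ((hg.continuous.comp (C y).continuous).clm_apply continuous_const).Icc_extend'
  -- Extending the integrand constantly outside `[0, 1]` defines the curve on all of `ℝ`, with
  -- two-sided derivatives at both endpoints.
  let Γ : P × E → ℝ → E := fun y s =>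
    y.2 + ∫ r in (0 : ℝ)..s, Set.IccExtend (zero_le_one (α := ℝ)) (fun s => g (C y s) y.1) r
  have hΓC : ∀ᶠ y in 𝓝 ((0 : P), x₀), ∀ s : unitInterval, Γ y s = C y s := by
    filter_upwards [hCe] with y hy s
    conv_rhs => rw [hy]
    rfl
  have hcont : ∀ O ∈ 𝓝 x₀, ∀ᶠ y in 𝓝 ((0 : P), x₀), ∀ s, C y s ∈ O := by
    intro O hO
    obtain ⟨ε, hε, hεO⟩ := Metric.mem_nhds_iff.1 hO
    have h1 : ∀ᶠ y in 𝓝 ((0 : P), x₀), C y ∈ Metric.ball (C (0, x₀)) ε :=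
      hC.self_of_nhds.continuousAt (Metric.ball_mem_nhds _ hε)
    filter_upwards [h1] with y hy s
    apply hεO
    have := (ContinuousMap.dist_apply_le_dist (f := C y) (g := C (0, x₀)) s).trans_lt hy
    rwa [hC₀] at this
  have hflow : ∀ O ∈ 𝓝 x₀, ∀ᶠ y in 𝓝 ((0 : P), x₀), Γ y 0 = y.2 ∧
        ∀ s ∈ Set.Icc (0 : ℝ) 1, Γ y s ∈ O ∧ HasDerivAt (Γ y) (ξ (Γ y s) y.1) s := by
    intro O hO
    filter_upwards [hΓC, hcont _ (Filter.inter_mem hO hgξ)] with y hy hyO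
    refine ⟨by simp [Γ], fun s hs => ?_⟩
    have h1 : Γ y s = C y ⟨s, hs⟩ := hy ⟨s, hs⟩
    have h2 := hyO ⟨s, hs⟩
    rw [h1]
    refine ⟨h2.1, ?_⟩
    have h3 : g (C y ⟨s, hs⟩) = ξ (C y ⟨s, hs⟩) := h2.2
    have h4 := ((hge y).integral_hasStrictDerivAt 0 s).hasDerivAt.const_add y.2
    rw [Set.IccExtend_of_mem _ _ hs, h3] at h4
    exact h4
  refine ⟨Γ, ?_, ?_, hflow⟩
  · filter_upwards [hC, hΓC.eventually_nhds] with y hy hy'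
    let ev : C(unitInterval, E) →L[ℝ] E := ContinuousMap.evalCLM ℝ (1 : unitInterval)
    have hev : ContDiff ℝ ∞ ev := ev.contDiff
    have h1 : ContDiffAt ℝ ∞ (fun y => C y 1) y := hev.contDiffAt.comp y hy
    refine h1.congr_of_eventuallyEq ?_
    filter_upwards [hy'] with z hz
    exact hz 1
  · rw [hasFDerivAt_iff_isLittleO, Asymptotics.isLittleO_iff]
    intro ε hε
    have hO : ∀ᶠ z in 𝓝 x₀, ‖ξ z - ξ x₀‖ < ε := by
      have := hξ.self_of_nhds.continuousAt (Metric.ball_mem_nhds _ hε)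
      filter_upwards [this] with z hz
      rwa [← dist_eq_norm]
    have h0 : Γ (0, x₀) 1 = x₀ := by
      have := hΓC.self_of_nhds 1
      rw [hC₀] at this
      exact this
    filter_upwards [hflow _ hO] with y hy
    -- Comparison with the straight motion of velocity `ξ x₀ y.1`: the difference has speed at most
    -- `ε * ‖y.1‖`, which is the remainder estimate for the derivative of the time-one map.
    have h1 := (convex_Icc (0 : ℝ) 1).norm_image_sub_le_of_norm_hasDerivWithin_le
      (f := fun s => Γ y s - s • ξ x₀ y.1) (f' := fun s => ξ (Γ y s) y.1 - ξ x₀ y.1)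
      (C := ε * ‖y.1‖) (x := 0) (y := 1)
      (fun s hs => ((hy.2 s hs).2.sub
        (by simpa using (hasDerivAt_id s).smul_const (ξ x₀ y.1))).hasDerivWithinAt)
      (fun s hs => by
        rw [← sub_apply]
        exact (ContinuousLinearMap.le_opNorm _ _).trans
          (mul_le_mul_of_nonneg_right (le_of_lt (hy.2 s hs).1) (norm_nonneg _)))
      (by simp) (by simp)
    simp only [one_smul, zero_smul, sub_zero, hy.1, norm_one, mul_one] at h1
    rw [h0]
    simp only [add_apply, ContinuousLinearMap.comp_apply,
      ContinuousLinearMap.coe_snd', ContinuousLinearMap.coe_fst', Prod.fst_sub, Prod.snd_sub,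
      sub_zero]
    refine le_trans (le_of_eq ?_) (h1.trans ?_)
    · congr 1
      abel
    · gcongr
      have : y.1 = (y - ((0 : P), x₀)).1 := by simp
      rw [this]
      exact norm_fst_le _

/-! ### Short closed orbits and the curve attached to a germ -/

/-- A closed orbit of period one of a Lipschitz vector field with constant less than one is
constant. -/
theorem eq_zero_of_closed_orbit {H : Type*} [NormedAddCommGroup H] [NormedSpace ℝ H]
    {v : H → H} {B : Set H} {L : ℝ} (hL : L < 1) (hL0 : 0 ≤ L)
    (hv : ∀ a ∈ B, ∀ b ∈ B, ‖v a - v b‖ ≤ L * ‖a - b‖) {y : ℝ → H}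
    (hyB : ∀ s ∈ Set.Icc (0 : ℝ) 1, y s ∈ B)
    (hy : ∀ s ∈ Set.Icc (0 : ℝ) 1, HasDerivAt y (v (y s)) s) (h01 : y 0 = y 1) :
    ∀ s ∈ Set.Icc (0 : ℝ) 1, v (y s) = 0 ∧ y s = y 0 := by
  have hcy : ContinuousOn y (Set.Icc 0 1) := fun s hs => (hy s hs).continuousAt.continuousWithinAt
  have hcv : ContinuousOn v B := by
    refine (LipschitzOnWith.of_dist_le_mul (K := ⟨L, hL0⟩) fun a ha b hb => ?_).continuousOn
    rw [dist_eq_norm, dist_eq_norm]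
    exact hv a ha b hb
  have hc : ContinuousOn (fun s => ‖v (y s)‖) (Set.Icc 0 1) := (hcv.comp hcy hyB).norm
  obtain ⟨t, ht, hmax⟩ := isCompact_Icc.exists_isMaxOn (Set.nonempty_Icc.2 zero_le_one) hc
  set m := ‖v (y t)‖
  have hm : ∀ s ∈ Set.Icc (0 : ℝ) 1, ‖v (y s)‖ ≤ m := fun s hs => hmax hs
  have hbound : ∀ s ∈ Set.Icc (0 : ℝ) 1, ‖y t - y s‖ ≤ m := fun s hs => by
    have h1 := (convex_Icc (0 : ℝ) 1).norm_image_sub_le_of_norm_hasDerivWithin_le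
      (fun s hs => (hy s hs).hasDerivWithinAt) hm hs ht
    refine h1.trans (mul_le_of_le_one_right (norm_nonneg _) ?_)
    rw [Real.norm_eq_abs, abs_le]
    constructor <;> linarith [hs.1, hs.2, ht.1, ht.2]
  -- Here `m` is the maximal speed, attained at time `t`. Over a full period the displacement of `y`
  -- cancels and only `v (y t)` remains, while the velocities differ from it by at most `L * m`. So
  -- `m ≤ L * m`, which forces `m = 0`.
  have h2 := (convex_Icc (0 : ℝ) 1).norm_image_sub_le_of_norm_hasDerivWithin_le
      (f := fun s => s • v (y t) - y s) (f' := fun s => v (y t) - v (y s))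
      (C := L * m) (x := 0) (y := 1)
      (fun s hs => (HasDerivAt.sub (by simpa using (hasDerivAt_id s).smul_const (v (y t)))
        (hy s hs)).hasDerivWithinAt)
      (fun s hs => (hv _ (hyB t ht) _ (hyB s hs)).trans
        (mul_le_mul_of_nonneg_left (hbound s hs) hL0)) (by simp) (by simp)
  have h3 : m ≤ L * m := by
    simpa [h01] using h2
  have hm0 : m = 0 := by
    have : 0 ≤ m := norm_nonneg _
    nlinarith
  have hz : ∀ s ∈ Set.Icc (0 : ℝ) 1, v (y s) = 0 := fun s hs =>
    norm_le_zero_iff.1 ((hm s hs).trans_eq hm0)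
  refine fun s hs => ⟨hz s hs, ?_⟩
  have h4 := (convex_Icc (0 : ℝ) 1).norm_image_sub_le_of_norm_hasDerivWithin_le
      (fun s hs => (hy s hs).hasDerivWithinAt) hm (show (0 : ℝ) ∈ Set.Icc (0 : ℝ) 1 by simp) hs
  rw [hm0, zero_mul] at h4
  exact sub_eq_zero.1 (norm_le_zero_iff.1 h4)

theorem eq_of_fderiv_eq_zero_along {E F : Type*} [NormedAddCommGroup E] [NormedSpace ℝ E]
    [NormedAddCommGroup F] [NormedSpace ℝ F] {f : E → F} {c : ℝ → E} {v : ℝ → E}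
    (hc : ∀ s ∈ Set.Icc (0 : ℝ) 1, HasDerivAt c (v s) s)
    (hf : ∀ s ∈ Set.Icc (0 : ℝ) 1, DifferentiableAt ℝ f (c s) ∧ fderiv ℝ f (c s) (v s) = 0)
    {s : ℝ} (hs : s ∈ Set.Icc (0 : ℝ) 1) : f (c s) = f (c 0) := by
  have h := (convex_Icc (0 : ℝ) 1).norm_image_sub_le_of_norm_hasDerivWithin_le
    (f := fun s => f (c s)) (f' := fun s => fderiv ℝ f (c s) (v s)) (C := 0) (x := 0) (y := s)
    (fun s hs => ((hf s hs).1.hasFDerivAt.comp_hasDerivAt s (hc s hs)).hasDerivWithinAt)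
    (fun s hs => by rw [(hf s hs).2, norm_zero]) (by simp) hs
  rw [zero_mul] at h
  exact sub_eq_zero.1 (norm_le_zero_iff.1 h)

/-- A submersion together with a projection to the kernel of its derivative is a local
coordinate system. -/
theorem exists_injOn_prod_of_surjective {E F : Type*} [NormedAddCommGroup E] [NormedSpace ℝ E]
    [FiniteDimensional ℝ E] [NormedAddCommGroup F] [NormedSpace ℝ F] [FiniteDimensional ℝ F]
    {f : E → F} {x₀ : E} (hf : ∀ᶠ y in 𝓝 x₀, ContDiffAt ℝ ∞ f y)
    (hs : Function.Surjective (fderiv ℝ f x₀))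
    (π : E →L[ℝ] (fderiv ℝ f x₀).ker) (hπ : ∀ k : (fderiv ℝ f x₀).ker, π k = k) :
    ∃ O ∈ 𝓝 x₀, ∀ a ∈ O, ∀ b ∈ O, f a = f b → π a = π b → a = b := by
  have : CompleteSpace E := FiniteDimensional.complete ℝ E
  let A : E →ₗ[ℝ] F × (fderiv ℝ f x₀).ker := ((fderiv ℝ f x₀).prod π : E →L[ℝ] _)
  have hinj : Function.Injective A := by
    rw [injective_iff_map_eq_zero]
    intro v hv
    have h1 : fderiv ℝ f x₀ v = 0 := congrArg Prod.fst hv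
    have h2 : π v = 0 := congrArg Prod.snd hv
    have h3 := hπ ⟨v, h1⟩
    rw [show π v = 0 from h2] at h3
    exact (congrArg Subtype.val h3).symm
  have hsurj : Function.Surjective A := by
    rintro ⟨a, k⟩
    obtain ⟨v, rfl⟩ := hs a
    refine ⟨v + (k - π v : (fderiv ℝ f x₀).ker), Prod.ext ?_ ?_⟩
    · change fderiv ℝ f x₀ (v + (k - π v : (fderiv ℝ f x₀).ker)) = _
      have hk : fderiv ℝ f x₀ (k - π v : (fderiv ℝ f x₀).ker) = 0 := (k - π v).2
      rw [map_add, hk, add_zero]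
    · change π (v + (k - π v : (fderiv ℝ f x₀).ker)) = _
      rw [map_add, hπ]
      simp
  let e := (LinearEquiv.ofBijective A ⟨hinj, hsurj⟩).toContinuousLinearEquiv
  have he : HasFDerivAt (fun y => (f y, π y)) (e : E →L[ℝ] _) x₀ :=
    (hf.self_of_nhds.differentiableAt (by simp)).hasFDerivAt.prodMk π.hasFDerivAt
  obtain ⟨g, hg, hgf, -⟩ := exists_openPartialHomeomorph_of_smooth
    (hf.mono fun y hy => hy.prodMk π.contDiff.contDiffAt) he
  refine ⟨g.source, g.open_source.mem_nhds hg, fun a ha b hb h1 h2 => g.injOn ha hb ?_⟩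
  rw [hgf, hgf, h1, h2]

/-- Let `ξ` be a frame of vertical vector fields for `f`, that are related by `q` to vector
fields `X`. Close to `x₀`, if a germ of map preserves `f` and `q` and sends `w` to `w'`, then `w` and
`w'` are joined by an integral curve of a field `ξ(·) k` with `k` the value at `w` of a function
`l` such that `ξ(z) l(z)` is in the kernel of the derivative of `q` for all `z` near `w`. -/
theorem exists_curve_of_germ {E : Type u} {F H : Type*} [NormedAddCommGroup E] [NormedSpace ℝ E]
    [FiniteDimensional ℝ E] [NormedAddCommGroup F] [NormedSpace ℝ F] [FiniteDimensional ℝ F]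
    [NormedAddCommGroup H] [NormedSpace ℝ H]
    {f : E → F} {q : E → H} {x₀ : E} (hf : ∀ᶠ y in 𝓝 x₀, ContDiffAt ℝ ∞ f y)
    (hs : Function.Surjective (fderiv ℝ f x₀)) (hq : ∀ᶠ y in 𝓝 x₀, ContDiffAt ℝ ∞ q y)
    {ξ : E → (fderiv ℝ f x₀).ker →L[ℝ] E} {X : H → (fderiv ℝ f x₀).ker →L[ℝ] H}
    (hξ : ∀ᶠ y in 𝓝 x₀, ContDiffAt ℝ ∞ ξ y) (hX : ContDiffAt ℝ ∞ X (q x₀))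
    (hξ₀ : ∀ k, ξ x₀ k = k) (hfξ : ∀ᶠ z in 𝓝 x₀, ∀ k, fderiv ℝ f z (ξ z k) = 0)
    (hqξ : ∀ᶠ z in 𝓝 x₀, ∀ k, fderiv ℝ q z (ξ z k) = X (q z) k) {S : Set E} (hS : S ∈ 𝓝 x₀) :
    ∃ U : Set E, IsOpen U ∧ x₀ ∈ U ∧ U ⊆ S ∧ ∀ w ∈ U, ∀ w' ∈ U, ∀ φ : E → E, φ w = w' →
      (∀ᶠ z in 𝓝 w, ContDiffAt ℝ ∞ φ z) → (∀ᶠ z in 𝓝 w, f (φ z) = f z ∧ q (φ z) = q z) →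
      ∃ l : E → (fderiv ℝ f x₀).ker,
        (∀ᶠ z in 𝓝 w, ContDiffAt ℝ ∞ l z ∧ X (q z) (l z) = 0) ∧
        ∃ c : ℝ → E, c 0 = w ∧ c 1 = w' ∧ ∀ t ∈ Set.Icc (0 : ℝ) 1, c t ∈ S ∧
          HasDerivAt c (ξ (c t) (l w)) t ∧ q (c t) = q w := by
  have : CompleteSpace E := FiniteDimensional.complete ℝ E
  have : CompleteSpace (fderiv ℝ f x₀).ker := FiniteDimensional.complete ℝ _
  obtain ⟨π₀, hπ₀⟩ := LinearMap.exists_leftInverse_of_injective (fderiv ℝ f x₀).ker.subtype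
    (Submodule.ker_subtype _)
  let π : E →L[ℝ] (fderiv ℝ f x₀).ker := π₀.toContinuousLinearMap
  have hπ : ∀ k : (fderiv ℝ f x₀).ker, π k = k := fun k => LinearMap.congr_fun hπ₀ k
  obtain ⟨O₁, hO₁, hinj⟩ := exists_injOn_prod_of_surjective hf hs π hπ
  obtain ⟨L, B, hB, hLB⟩ := (hX.of_le (m := 1) (by simp)).exists_lipschitzOnWith
  obtain ⟨Γ, hΓ, hΓ', hflow⟩ := exists_smooth_flow hξ
  have hqB : ∀ᶠ z in 𝓝 x₀, q z ∈ B := hq.self_of_nhds.continuousAt hB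
  let O : Set E := {z | z ∈ O₁ ∧ z ∈ S ∧ q z ∈ B ∧ ContDiffAt ℝ ∞ f z ∧ ContDiffAt ℝ ∞ q z ∧
    (∀ k, fderiv ℝ f z (ξ z k) = 0) ∧ ∀ k, fderiv ℝ q z (ξ z k) = X (q z) k}
  have hO : O ∈ 𝓝 x₀ := by
    filter_upwards [hO₁, hS, hqB, hf, hq, hfξ, hqξ] with z h1 h2 h3 h4 h5 h6 h7
    exact ⟨h1, h2, h3, h4, h5, h6, h7⟩
  -- The field `X(·) k` has Lipschitz constant `L * ‖k‖` on `B`. Making it less than one excludes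
  -- nonconstant orbits of period one.
  have hsmall : ∀ᶠ y in 𝓝 ((0 : (fderiv ℝ f x₀).ker), x₀), L * ‖y.1‖ < 1 := by
    have : Continuous (fun y : (fderiv ℝ f x₀).ker × E => (L : ℝ) * ‖y.1‖) := by fun_prop
    exact this.continuousAt.eventually_lt continuousAt_const (by simp)
  obtain ⟨A, hA, hAo, hA₀⟩ := eventually_nhds_iff.1 ((hflow O hO).and hsmall)
  -- The shooting map records the kernel coordinate of the endpoint and the starting point. Since `ξ
  -- x₀` is the inclusion of the kernel, its derivative is `(k, v) ↦ (k + π v, v)`, which is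
  -- invertible.
  let G : (fderiv ℝ f x₀).ker × E → (fderiv ℝ f x₀).ker × E := fun y => (π (Γ y 1), y.2)
  let fs := ContinuousLinearMap.fst ℝ (fderiv ℝ f x₀).ker E
  let sn := ContinuousLinearMap.snd ℝ (fderiv ℝ f x₀).ker E
  let G' : ((fderiv ℝ f x₀).ker × E) ≃L[ℝ] ((fderiv ℝ f x₀).ker × E) :=
    ContinuousLinearEquiv.equivOfInverse ((fs + π ∘L sn).prod sn) ((fs - π ∘L sn).prod sn)
      (fun y => by simp [fs, sn]) (fun y => by simp [fs, sn])
  have hG' : HasFDerivAt G (G' : _ →L[ℝ] _) (0, x₀) := by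
    refine ((π.hasFDerivAt.comp _ hΓ').prodMk hasFDerivAt_snd).congr_fderiv ?_
    refine ContinuousLinearMap.ext fun y => Prod.ext ?_ rfl
    change π (y.2 + ξ x₀ y.1) = y.1 + π y.2
    rw [map_add, hξ₀, hπ, add_comm]
  obtain ⟨e₀, he₀, heG, hes⟩ := exists_openPartialHomeomorph_of_smooth (f := G) (f' := G')
    (a := (0, x₀)) (hΓ.mono fun y hy => (π.contDiff.contDiffAt.comp y hy).prodMk contDiffAt_snd) hG'
  let e := e₀.restrOpen A hAo
  have hGx : G (0, x₀) = (π x₀, x₀) := by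
    have h1 := (hflow Set.univ Filter.univ_mem).self_of_nhds
    -- At parameter `0` the velocity is zero, so the orbit of `x₀` stays at `x₀`.
    have h2 := eq_of_fderiv_eq_zero_along (f := fun z : E => z) (c := Γ (0, x₀)) (v := fun _ => 0)
      (fun s hs => by simpa using (h1.2 s hs).2) (fun s hs => ⟨differentiableAt_id, map_zero _⟩)
      (s := 1) (by simp)
    simp only [G, h2, h1.1]
  have het : (π x₀, x₀) ∈ e.target := by
    rw [← hGx, ← heG]
    exact e.map_source ⟨he₀, hA₀⟩
  have hpair : ∀ᶠ y : E × E in 𝓝 (x₀, x₀), (π y.1, y.2) ∈ e.target := by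
    have : Continuous (fun y : E × E => (π y.1, y.2)) := by fun_prop
    exact this.continuousAt.preimage_mem_nhds (e.open_target.mem_nhds het)
  -- A product neighbourhood is needed so that `U` serves all pairs `w`, `w'` at once, independently
  -- of the germ.
  rw [nhds_prod_eq] at hpair
  obtain ⟨t, ht, htt⟩ := Filter.mem_prod_self_iff.1 hpair
  obtain ⟨U, hU, hUo, hxU⟩ := mem_nhds_iff.1 (Filter.inter_mem ht hO)
  refine ⟨U, hUo, hxU, fun z hz => (hU hz).2.2.1, fun w hw w' hw' φ hφw hφ hφfq => ?_⟩
  -- The parameter whose time-one flow sends `z` to a point with the kernel coordinate of `φ z`.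
  let l : E → (fderiv ℝ f x₀).ker := fun z => (e.symm (π (φ z), z)).1
  have hφc : ContinuousAt φ w := hφ.self_of_nhds.continuousAt
  have hφU : ∀ᶠ z in 𝓝 w, φ z ∈ U :=
    hφc.preimage_mem_nhds (hUo.mem_nhds (by rwa [hφw]))
  have hzt : ∀ᶠ z in 𝓝 w, (π (φ z), z) ∈ e.target := by
    filter_upwards [hφU, hUo.mem_nhds hw] with z h1 h2
    exact htt (Set.mk_mem_prod (hU h1).1 (hU h2).1)
  have key : ∀ᶠ z in 𝓝 w, Γ (l z, z) 0 = z ∧ Γ (l z, z) 1 = φ z ∧ X (q z) (l z) = 0 ∧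
      ∀ s ∈ Set.Icc (0 : ℝ) 1, Γ (l z, z) s ∈ S ∧
        HasDerivAt (Γ (l z, z)) (ξ (Γ (l z, z) s) (l z)) s ∧ q (Γ (l z, z) s) = q z := by
    filter_upwards [hφU, hzt, hφfq] with z hzU hzt hzfq
    have h1 : G (e.symm (π (φ z), z)) = (π (φ z), z) := by
      rw [← heG]
      exact e.right_inv hzt
    have h2 : (e.symm (π (φ z), z)).2 = z := congrArg Prod.snd h1
    have h3 : e.symm (π (φ z), z) = (l z, z) := Prod.ext rfl h2
    have h4 : (l z, z) ∈ A := by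
      rw [← h3]
      exact (e.map_target hzt).2
    obtain ⟨⟨h5, h6⟩, h7⟩ := hA _ h4
    have h8 : f (Γ (l z, z) 1) = f (Γ (l z, z) 0) :=
      eq_of_fderiv_eq_zero_along (fun s hs => (h6 s hs).2)
        (fun s hs => ⟨(h6 s hs).1.2.2.2.1.differentiableAt (by simp),
          (h6 s hs).1.2.2.2.2.2.1 _⟩) (by simp)
    have h9 : Γ (l z, z) 1 = φ z := by
      -- The flow and `φ` both preserve `f`, and the endpoints share their kernel coordinate. These
      -- data are local coordinates, so the endpoints coincide.
      refine hinj _ (h6 1 (by simp)).1.1 _ (hU hzU).2.1 ?_ ?_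
      · rw [h8, h5, hzfq.1]
      · rw [h3] at h1
        exact congrArg Prod.fst h1
    -- The image of the orbit under `q` closes up because `φ` preserves `q`.
    have h10 := eq_zero_of_closed_orbit (v := fun a => X a (l z)) (B := B)
      (L := L * ‖l z‖) h7 (by positivity)
      (fun a ha b hb => by
        rw [← sub_apply]
        refine (ContinuousLinearMap.le_opNorm _ _).trans ?_
        have := hLB.dist_le_mul a ha b hb
        rw [dist_eq_norm, dist_eq_norm] at this
        calc _ ≤ (L * ‖a - b‖) * ‖l z‖ := by gcongr
          _ = _ := by ring)
      (y := fun s => q (Γ (l z, z) s)) (fun s hs => (h6 s hs).1.2.2.1)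
      (fun s hs => by
        have := ((h6 s hs).1.2.2.2.2.1.differentiableAt (by simp)).hasFDerivAt.comp_hasDerivAt s
          (h6 s hs).2
        rw [(h6 s hs).1.2.2.2.2.2.2] at this
        exact this)
      (by rw [h9, h5, hzfq.2])
    refine ⟨h5, h9, ?_, fun s hs => ⟨(h6 s hs).1.2.1, (h6 s hs).2, ?_⟩⟩
    · have := (h10 0 (by simp)).1
      simp only [h5] at this
      exact this
    · have := (h10 s hs).2
      simp only [h5] at this
      exact this
  refine ⟨l, ?_, Γ (l w, w), ?_⟩
  · filter_upwards [hzt, hφ, key] with z h1 h2 h3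
    refine ⟨?_, h3.2.2.1⟩
    have h4 : ContDiffAt ℝ ∞ e₀.symm (π (φ z), z) := hes _ h1.1
    have h5 : ContDiffAt ℝ ∞ (fun z => (π (φ z), z)) z :=
      (π.contDiff.contDiffAt.comp z h2).prodMk contDiffAt_id
    exact contDiffAt_fst.comp z (ContDiffAt.comp (g := e₀.symm) z h4 h5)
  · obtain ⟨h1, h2, -, h3⟩ := key.self_of_nhds
    exact ⟨h1, h2.trans hφw, h3⟩

/-! ### Flows as local diffeomorphisms -/

/-- Near `x₀`, the time `ε` flow of a smooth vector field `Z` is a local diffeomorphism for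
small `ε`. -/
theorem exists_flow_diffeo {E : Type} [NormedAddCommGroup E] [NormedSpace ℝ E]
    [FiniteDimensional ℝ E] {Z : E → E} {x₀ : E} (hZ : ∀ᶠ y in 𝓝 x₀, ContDiffAt ℝ ∞ Z y)
    {S : Set E} (hS : S ∈ 𝓝 x₀) :
    ∃ S' ∈ 𝓝 x₀, ∀ᶠ ε in 𝓝 (0 : ℝ), ∃ f : OpenPartialHomeomorph E E, x₀ ∈ f.source ∧
      (∀ z ∈ f.source, ContDiffAt ℝ ∞ f z ∧ ∃ c : ℝ → E, c 0 = z ∧ c 1 = f z ∧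
        ∀ s ∈ Set.Icc (0 : ℝ) 1, c s ∈ S ∧ HasDerivAt c (ε • Z (c s)) s) ∧
      (∀ y ∈ f.target, ContDiffAt ℝ ∞ f.symm y) ∧
      ∀ c : ℝ → E, c 0 = x₀ → (∀ s ∈ Set.Icc (0 : ℝ) 1, c s ∈ S' ∧
        HasDerivWithinAt c (ε • Z (c s)) (Set.Icc 0 1) s) → c 1 = f x₀ := by
  have : CompleteSpace E := FiniteDimensional.complete ℝ E
  let ξ : E → ℝ →L[ℝ] E := fun z => ContinuousLinearMap.toSpanSingleton ℝ (Z z)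
  have hξ : ∀ᶠ y in 𝓝 x₀, ContDiffAt ℝ ∞ ξ y := by
    filter_upwards [hZ] with y hy
    exact (ContinuousLinearMap.toSpanSingletonCLE (𝕜 := ℝ) (E := E)).contDiff.contDiffAt.comp y hy
  have hξa : ∀ z t, ξ z t = t • Z z := fun z t => by simp [ξ]
  obtain ⟨L, B, hB, hLB⟩ := (hZ.self_of_nhds.of_le (m := 1) (by simp)).exists_lipschitzOnWith
  obtain ⟨Γ, hΓ, hΓ', hflow⟩ := exists_smooth_flow hξ
  let fs := ContinuousLinearMap.fst ℝ ℝ E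
  let sn := ContinuousLinearMap.snd ℝ ℝ E
  -- Keeping the time as a coordinate yields one local inverse for all small times. Its slice at `ε`
  -- inverts the time-`ε` map.
  let G : ℝ × E → ℝ × E := fun y => (y.1, Γ y 1)
  let G' : (ℝ × E) ≃L[ℝ] (ℝ × E) :=
    ContinuousLinearEquiv.equivOfInverse (fs.prod (sn + ξ x₀ ∘L fs)) (fs.prod (sn - ξ x₀ ∘L fs))
      (fun y => by simp [fs, sn]) (fun y => by simp [fs, sn])
  have hG' : HasFDerivAt G (G' : _ →L[ℝ] _) (0, x₀) := hasFDerivAt_fst.prodMk hΓ'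
  obtain ⟨e₀, he₀, heG₀, hes₀⟩ := exists_openPartialHomeomorph_of_smooth (f := G) (f' := G')
    (a := (0, x₀)) (hΓ.mono fun y hy => contDiffAt_fst.prodMk hy) hG'
  obtain ⟨A, hA, hAo, hA₀⟩ := eventually_nhds_iff.1
    (hΓ.and (hflow _ (Filter.inter_mem hS hB)))
  obtain ⟨e, he, heA, heG, hes⟩ : ∃ e : OpenPartialHomeomorph (ℝ × E) (ℝ × E),
      (0, x₀) ∈ e.source ∧ e.source ⊆ A ∧ (∀ y, e y = G y) ∧
        ∀ y ∈ e.target, ContDiffAt ℝ ∞ e.symm y :=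
    ⟨e₀.restrOpen A hAo, ⟨he₀, hA₀⟩, fun y hy => hy.2, heG₀, fun y hy => hes₀ y hy.1⟩
  have hfst : ∀ y ∈ e.target, (e.symm y).1 = y.1 := by
    intro y hy
    have h1 : G (e.symm y) = y := by
      rw [← heG]
      exact e.right_inv hy
    have h2 : (G (e.symm y)).1 = y.1 := by rw [h1]
    exact h2
  refine ⟨B, hB, ?_⟩
  have hline : ContinuousAt (fun ε : ℝ => (ε, x₀)) 0 := by fun_prop
  filter_upwards [hline.preimage_mem_nhds (e.open_source.mem_nhds he)] with ε hε
  have hcd : ∀ z, (ε, z) ∈ e.source → ContDiffAt ℝ ∞ (fun z => Γ (ε, z) 1) z := fun z hz =>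
    ContDiffAt.comp (g := fun y => Γ y 1) z (hA _ (heA hz)).1
      (contDiffAt_const.prodMk contDiffAt_id)
  have hcds : ∀ y, (ε, y) ∈ e.target → ContDiffAt ℝ ∞ (fun y => (e.symm (ε, y)).2) y :=
    fun y hy => contDiffAt_snd.comp y
      (ContDiffAt.comp (g := e.symm) y (hes _ hy) (contDiffAt_const.prodMk contDiffAt_id))
  have hΓe : ∀ z, (ε, Γ (ε, z) 1) = e (ε, z) := fun z => (heG (ε, z)).symm
  have hsymm : ∀ y, (ε, y) ∈ e.target → (ε, (e.symm (ε, y)).2) = e.symm (ε, y) := fun y hy =>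
    Prod.ext (hfst _ hy).symm rfl
  let f : OpenPartialHomeomorph E E :=
    { toFun := fun z => Γ (ε, z) 1
      invFun := fun y => (e.symm (ε, y)).2
      source := {z | (ε, z) ∈ e.source}
      target := {y | (ε, y) ∈ e.target}
      map_source' := fun z hz => by
        change (ε, Γ (ε, z) 1) ∈ e.target
        rw [hΓe]
        exact e.map_source hz
      map_target' := fun y hy => by
        change (ε, (e.symm (ε, y)).2) ∈ e.source
        rw [hsymm y hy]
        exact e.map_target hy
      left_inv' := fun z hz => by
        rw [hΓe, e.left_inv hz]
      right_inv' := fun y hy => by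
        have h1 := hΓe (e.symm (ε, y)).2
        rw [hsymm y hy, e.right_inv hy, ← hsymm y hy] at h1
        exact congrArg Prod.snd h1
      open_source := e.open_source.preimage (Continuous.prodMk_right ε)
      open_target := e.open_target.preimage (Continuous.prodMk_right ε)
      continuousOn_toFun := fun z hz => (hcd z hz).continuousAt.continuousWithinAt
      continuousOn_invFun := fun y hy => (hcds y hy).continuousAt.continuousWithinAt }
  refine ⟨f, hε, fun z hz => ⟨hcd z hz, Γ (ε, z), (hA _ (heA hz)).2.1, rfl, fun s hs => ?_⟩,
    fun y hy => hcds y hy, fun c hc0 hc => ?_⟩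
  · have := (hA _ (heA hz)).2.2 s hs
    rw [hξa] at this
    exact ⟨this.1.1, this.2⟩
  · have hx := hA _ (heA hε)
    -- Uniqueness of solutions uses derivatives from the right on `[0, 1)`, which derivatives within
    -- `[0, 1]` provide.
    have hIci : ∀ t ∈ Set.Ico (0 : ℝ) 1, Set.Icc (0 : ℝ) 1 ∈ 𝓝[≥] t := fun t ht =>
      Filter.mem_of_superset (Icc_mem_nhdsGE ht.2) (Set.Icc_subset_Icc_left ht.1)
    refine ODE_solution_unique_of_mem_Icc_right (v := fun _ z => ε • Z z) (s := fun _ => B)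
      (K := ‖ε‖₊ * L) (a := 0) (b := 1) (f := c) (g := Γ (ε, x₀))
      (fun t _ => (lipschitzWith_smul ε).comp_lipschitzOnWith hLB)
      (fun s hs => (hc s hs).2.continuousWithinAt)
      (fun t ht => (hc t (Set.Ico_subset_Icc_self ht)).2.mono_of_mem_nhdsWithin (hIci t ht))
      (fun t ht => (hc t (Set.Ico_subset_Icc_self ht)).1)
      (fun s hs => (hx.2.2 s hs).2.continuousAt.continuousWithinAt)
      (fun t ht => ?_) (fun t ht => (hx.2.2 t (Set.Ico_subset_Icc_self ht)).1.2)
      (by rw [hc0, hx.2.1]) (by simp)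
    have := (hx.2.2 t (Set.Ico_subset_Icc_self ht)).2.hasDerivWithinAt (s := Set.Ici t)
    rwa [hξa] at this

/-! ### Maps, vector fields and curves read in charts -/

section Charts

variable (E : Type*) [NormedAddCommGroup E] [NormedSpace ℝ E]
  {M : Type*} [TopologicalSpace M] [ChartedSpace E M]
  (F : Type*) [NormedAddCommGroup F] [NormedSpace ℝ F]
  {N : Type*} [TopologicalSpace N] [ChartedSpace F N]

/-- The derivative at `z` of the preferred chart at `x`. -/
noncomputable def chartDeriv (x z : M) : E →L[ℝ] E :=
  mfderiv 𝓘(ℝ, E) 𝓘(ℝ, E) (chartAt E x) z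

/-- The derivative at `u` of the inverse of the preferred chart at `x`. -/
noncomputable def chartSymmDeriv (x : M) (u : E) : E →L[ℝ] E :=
  mfderiv 𝓘(ℝ, E) 𝓘(ℝ, E) (chartAt E x).symm u

/-- The derivative of a map between manifolds, as a map between the model spaces. -/
noncomputable def mapDeriv (f : M → N) (z : M) : E →L[ℝ] F :=
  mfderiv 𝓘(ℝ, E) 𝓘(ℝ, F) f z

/-- The expression of a map in the preferred charts at `x` and `y`. -/
noncomputable def inCharts (x : M) (y : N) (f : M → N) : E → F :=
  fun u => chartAt F y (f ((chartAt E x).symm u))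

/-- The expression of a vector field in the preferred chart at `x`. -/
noncomputable def fieldInChart (x : M) (Z : M → E) : E → E :=
  fun u => chartDeriv E x ((chartAt E x).symm u) (Z ((chartAt E x).symm u))

variable {E} in
theorem fieldInChart_apply {x z : M} (hz : z ∈ (chartAt E x).source) (Z : M → E) :
    fieldInChart E x Z (chartAt E x z) = chartDeriv E x z (Z z) := by
  rw [fieldInChart, (chartAt E x).left_inv hz]

/-- The vector field with a given expression in the preferred chart at `x`. -/
noncomputable def fieldOfChart (x : M) (f : E → E) : M → E :=
  fun z => chartSymmDeriv E x (chartAt E x z) (f (chartAt E x z))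

/-- The vector field `Z` is smooth at `z`. -/
def FieldSmoothAt [IsManifold 𝓘(ℝ, E) ∞ M] (Z : M → E) (z : M) : Prop :=
  ContMDiffAt 𝓘(ℝ, E) 𝓘(ℝ, E).tangent ∞ (fun z => (⟨z, Z z⟩ : TangentBundle 𝓘(ℝ, E) M)) z

variable {E F} [IsManifold 𝓘(ℝ, E) ∞ M] [IsManifold 𝓘(ℝ, F) ∞ N]

theorem contMDiffAt_chartAt {x z : M} (hz : z ∈ (chartAt E x).source) :
    ContMDiffAt 𝓘(ℝ, E) 𝓘(ℝ, E) ∞ (chartAt E x) z :=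
  contMDiffOn_chart.contMDiffAt ((chartAt E x).open_source.mem_nhds hz)

theorem contMDiffAt_chartAt_symm {x : M} {u : E} (hu : u ∈ (chartAt E x).target) :
    ContMDiffAt 𝓘(ℝ, E) 𝓘(ℝ, E) ∞ (chartAt E x).symm u :=
  contMDiffOn_chart_symm.contMDiffAt ((chartAt E x).open_target.mem_nhds hu)

theorem chartAt_mdifferentiable (x : M) :
    (chartAt E x).MDifferentiable 𝓘(ℝ, E) 𝓘(ℝ, E) :=
  have : IsManifold 𝓘(ℝ, E) 1 M := IsManifold.of_le (n := ∞) (by simp)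
  mdifferentiable_chart x

theorem chartSymmDeriv_chartDeriv {x z : M} (hz : z ∈ (chartAt E x).source) (v : E) :
    chartSymmDeriv E x (chartAt E x z) (chartDeriv E x z v) = v :=
  DFunLike.congr_fun ((chartAt_mdifferentiable (E := E) x).symm_comp_deriv hz) v

theorem chartDeriv_chartSymmDeriv {x z : M} (hz : z ∈ (chartAt E x).source) (v : E) :
    chartDeriv E x z (chartSymmDeriv E x (chartAt E x z) v) = v := by
  have h : chartDeriv E x ((chartAt E x).symm (chartAt E x z))
      (chartSymmDeriv E x (chartAt E x z) v) = v :=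
    DFunLike.congr_fun ((chartAt_mdifferentiable (E := E) x).comp_symm_deriv
      ((chartAt E x).map_source hz)) v
  rwa [(chartAt E x).left_inv hz] at h

/-- The derivative of a chart, as a linear equivalence. -/
noncomputable def chartDerivEquiv {x z : M} (hz : z ∈ (chartAt E x).source) : E ≃L[ℝ] E :=
  ContinuousLinearEquiv.equivOfInverse (chartDeriv E x z) (chartSymmDeriv E x (chartAt E x z))
    (chartSymmDeriv_chartDeriv hz) (chartDeriv_chartSymmDeriv hz)

theorem chartDeriv_injective {x z : M} (hz : z ∈ (chartAt E x).source) :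
    Function.Injective (chartDeriv E x z) := (chartDerivEquiv hz).injective

theorem chartDeriv_fieldOfChart {x z : M} (hz : z ∈ (chartAt E x).source) (f : E → E) :
    chartDeriv E x z (fieldOfChart E x f z) = f (chartAt E x z) :=
  chartDeriv_chartSymmDeriv hz _

theorem contDiffAt_inCharts {x : M} {y : N} {f : M → N} {z : M} (hz : z ∈ (chartAt E x).source)
    (hf : ContMDiffAt 𝓘(ℝ, E) 𝓘(ℝ, F) ∞ f z) (hfz : f z ∈ (chartAt F y).source) :
    ContDiffAt ℝ ∞ (inCharts E F x y f) (chartAt E x z) := by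
  rw [← contMDiffAt_iff_contDiffAt]
  have h1 : ContMDiffAt 𝓘(ℝ, E) 𝓘(ℝ, E) ∞ (chartAt E x).symm (chartAt E x z) :=
    contMDiffAt_chartAt_symm ((chartAt E x).map_source hz)
  have h2 : (chartAt E x).symm (chartAt E x z) = z := (chartAt E x).left_inv hz
  have h3 : ContMDiffAt 𝓘(ℝ, E) 𝓘(ℝ, F) ∞ (f ∘ (chartAt E x).symm) (chartAt E x z) :=
    ContMDiffAt.comp _ (by rwa [h2]) h1
  exact ContMDiffAt.comp (g := chartAt F y) _
    (contMDiffAt_chartAt (by rwa [h2])) h3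

theorem fderiv_inCharts {x : M} {y : N} {f : M → N} {z : M} (hz : z ∈ (chartAt E x).source)
    (hf : ContMDiffAt 𝓘(ℝ, E) 𝓘(ℝ, F) ∞ f z) (hfz : f z ∈ (chartAt F y).source) (v : E) :
    fderiv ℝ (inCharts E F x y f) (chartAt E x z) (chartDeriv E x z v) =
      chartDeriv F y (f z) (mapDeriv E F f z v) := by
  have hfd := hf.mdifferentiableAt (by simp)
  have h1 : MDifferentiableAt 𝓘(ℝ, E) 𝓘(ℝ, F) (inCharts E F x y f) (chartAt E x z) :=
    ((contDiffAt_inCharts hz hf hfz).differentiableAt (by simp)).mdifferentiableAt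
  have h2 := mfderiv_comp z h1 ((contMDiffAt_chartAt hz).mdifferentiableAt (by simp))
  have h3 := mfderiv_comp z ((contMDiffAt_chartAt hfz).mdifferentiableAt (by simp)) hfd
  have h4 : inCharts E F x y f ∘ chartAt E x =ᶠ[𝓝 z] chartAt F y ∘ f := by
    filter_upwards [(chartAt E x).open_source.mem_nhds hz] with a ha
    simp only [Function.comp_apply, inCharts, (chartAt E x).left_inv ha]
  rw [h4.mfderiv_eq, h3, mfderiv_eq_fderiv] at h2
  exact (DFunLike.congr_fun h2 v).symm

/-- Near `z` this field is the pullback of `f` along the chart, a local diffeomorphism, and such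
pullbacks are smooth. -/
theorem contMDiffAt_fieldOfChart [CompleteSpace E] {x z : M} (hz : z ∈ (chartAt E x).source)
    {f : E → E} (hf : ContDiffAt ℝ ∞ f (chartAt E x z)) :
    FieldSmoothAt E (fieldOfChart E x f) z := by
  let V : (u : E) → TangentSpace 𝓘(ℝ, E) u := f
  have h1 := ContMDiffAt.mpullback_vectorField_preimage (n := ∞) (m := ∞) (V := V)
    (contMDiffAt_vectorSpace_iff_contDiffAt.2 hf) (contMDiffAt_chartAt hz)
    ⟨chartDerivEquiv (E := E) hz, rfl⟩ (by simp)
  refine h1.congr_of_eventuallyEq ?_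
  filter_upwards [(chartAt E x).open_source.mem_nhds hz] with a ha
  refine congrArg (Bundle.TotalSpace.mk a) ?_
  exact (DFunLike.congr_fun (ContinuousLinearMap.inverse_equiv (chartDerivEquiv ha)) _).symm

/-- The local expression is the pullback of `Z` along the inverse of the chart. -/
theorem contDiffAt_fieldInChart [CompleteSpace E] {x z : M} (hz : z ∈ (chartAt E x).source)
    {Z : M → E} (hZ : FieldSmoothAt E Z z) :
    ContDiffAt ℝ ∞ (fieldInChart E x Z) (chartAt E x z) := by
  let V : (u : M) → TangentSpace 𝓘(ℝ, E) u := Z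
  have hzt := (chartAt E x).map_source hz
  have h0 : (chartAt E x).symm (chartAt E x z) = z := (chartAt E x).left_inv hz
  have hinv : ∀ u (hu : u ∈ (chartAt E x).target),
      mfderiv 𝓘(ℝ, E) 𝓘(ℝ, E) (chartAt E x).symm u =
        ((chartDerivEquiv ((chartAt E x).map_target hu)).symm : E →L[ℝ] E) := by
    intro u hu
    change chartSymmDeriv E x u =
      chartSymmDeriv E x (chartAt E x ((chartAt E x).symm u))
    rw [(chartAt E x).right_inv hu]
  have h1 := ContMDiffAt.mpullback_vectorField_preimage (n := ∞) (m := ∞) (V := V)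
    (f := (chartAt E x).symm) (x₀ := chartAt E x z)
    (by rw [h0]; exact hZ) (contMDiffAt_chartAt_symm hzt) ⟨_, (hinv _ hzt).symm⟩ (by simp)
  refine contMDiffAt_vectorSpace_iff_contDiffAt.1 (h1.congr_of_eventuallyEq ?_)
  filter_upwards [(chartAt E x).open_target.mem_nhds hzt] with u hu
  refine congrArg (Bundle.TotalSpace.mk u) ?_
  have h2 := DFunLike.congr_fun (ContinuousLinearMap.inverse_equiv
    (chartDerivEquiv ((chartAt E x).map_target hu)).symm) (V ((chartAt E x).symm u))
  refine Eq.trans ?_ (h2.symm.trans ?_)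
  · rfl
  · exact congrArg (fun A : E →L[ℝ] E => A.inverse (V ((chartAt E x).symm u))) (hinv u hu).symm

theorem hasMFDerivAt_chartAt_symm_comp {x : M} {c : ℝ → E} {v : E} {t : ℝ}
    (hc : HasDerivAt c v t) (ht : c t ∈ (chartAt E x).target) :
    HasMFDerivAt 𝓘(ℝ, ℝ) 𝓘(ℝ, E) (fun s => (chartAt E x).symm (c s)) t
      ((1 : ℝ →L[ℝ] ℝ).smulRight (chartSymmDeriv E x (c t) v)) := by
  have h1 := ((contMDiffAt_chartAt_symm ht).mdifferentiableAt (by simp)).hasMFDerivAt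
  have h2 := h1.comp t hc.hasFDerivAt.hasMFDerivAt
  refine h2.congr_mfderiv ?_
  refine ContinuousLinearMap.ext fun r => ?_
  have h3 : ∀ (r : ℝ) (w : E), chartSymmDeriv E x (c t) (r • w) = r • chartSymmDeriv E x (c t) w :=
    map_smul _
  exact h3 r v

theorem hasDerivWithinAt_chartAt_comp {x : M} {γ : ℝ → M} {t : ℝ} {s : Set ℝ}
    {v : TangentSpace 𝓘(ℝ, E) (γ t)}
    (hγ : HasMFDerivWithinAt 𝓘(ℝ, ℝ) 𝓘(ℝ, E) γ s t ((1 : ℝ →L[ℝ] ℝ).smulRight v))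
    (ht : γ t ∈ (chartAt E x).source) :
    HasDerivWithinAt (fun r => chartAt E x (γ r)) (chartDeriv E x (γ t) v) s t := by
  have h1 := ((contMDiffAt_chartAt ht).mdifferentiableAt (by simp)).hasMFDerivAt
  have h2 := (h1.comp_hasMFDerivWithinAt t hγ).hasFDerivWithinAt
  rw [hasDerivWithinAt_iff_hasFDerivWithinAt]
  refine h2.congr_fderiv ?_
  refine ContinuousLinearMap.ext fun r => ?_
  have h3 : ∀ (r : ℝ) (w : E), chartDeriv E x (γ t) (r • w) = r • chartDeriv E x (γ t) w :=
    map_smul _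
  exact h3 r v

end Charts

/-! ### Submersions: local sections and derivatives -/

section Submersions

variable {E : Type*} [NormedAddCommGroup E] [NormedSpace ℝ E]
  {M : Type*} [TopologicalSpace M] [ChartedSpace E M]
  {F : Type*} [NormedAddCommGroup F] [NormedSpace ℝ F]
  {N : Type*} [TopologicalSpace N] [ChartedSpace F N]

/-- Submersions have smooth local sections through every point. -/
theorem Manifold.IsSubmersionAt.exists_local_section {f : M → N} {v : M}
    (h : Manifold.IsSubmersionAt 𝓘(ℝ, E) 𝓘(ℝ, F) ∞ f v) :
    ∃ σ : N → M, σ (f v) = v ∧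
      ∀ᶠ y in 𝓝 (f v), ContMDiffAt 𝓘(ℝ, F) 𝓘(ℝ, E) ∞ σ y ∧ f (σ y) = y := by
  have hw : ∀ u ∈ h.domChart.target, h.codChart (f (h.domChart.symm u)) = (h.equiv u).1 := by
    intro u hu
    have hu' : u ∈ (h.domChart.extend 𝓘(ℝ, E)).target := by simpa using hu
    simpa using h.writtenInCharts hu'
  have hv := h.mem_domChart_source
  -- In the normal form a submersion is a linear projection. The section freezes the complementary
  -- coordinate at its value at `v`.
  let g : N → E := fun y => h.equiv.symm (h.codChart y, (h.equiv (h.domChart v)).2)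
  have hgv : g (f v) = h.domChart v := by
    have := hw _ (h.domChart.map_source hv)
    rw [h.domChart.left_inv hv] at this
    simp only [g, this, Prod.mk.eta, ContinuousLinearEquiv.symm_apply_apply]
  have hgs : ∀ y ∈ h.codChart.source, ContMDiffAt 𝓘(ℝ, F) 𝓘(ℝ, E) ∞ g y := by
    intro y hy
    have h1 : ContMDiffAt 𝓘(ℝ, F) 𝓘(ℝ, F) ∞ h.codChart y :=
      contMDiffAt_of_mem_maximalAtlas h.codChart_mem_maximalAtlas hy
    have h2 : ContDiff ℝ ∞ (fun a : F => h.equiv.symm (a, (h.equiv (h.domChart v)).2)) :=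
      h.equiv.symm.contDiff.comp (contDiff_id.prodMk contDiff_const)
    exact h2.contMDiff.contMDiffAt.comp y h1
  refine ⟨fun y => h.domChart.symm (g y), ?_, ?_⟩
  · simp only [hgv, h.domChart.left_inv hv]
  · have h1 : ∀ᶠ y in 𝓝 (f v), g y ∈ h.domChart.target := by
      refine (hgs _ h.mem_codChart_source).continuousAt.preimage_mem_nhds
        (h.domChart.open_target.mem_nhds ?_)
      rw [hgv]
      exact h.domChart.map_source hv
    filter_upwards [h1, h.codChart.open_source.mem_nhds h.mem_codChart_source] with y hy hy'
    refine ⟨ContMDiffAt.comp (g := h.domChart.symm) y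
      (contMDiffAt_symm_of_mem_maximalAtlas h.domChart_mem_maximalAtlas hy) (hgs y hy'), ?_⟩
    refine h.codChart.injOn (h.source_subset_preimage_source (h.domChart.map_target hy)) hy' ?_
    rw [hw _ hy]
    simp [g]

/-- The derivative of a local section through `v` is a right inverse. -/
theorem Manifold.IsSubmersionAt.mapDeriv_surjective {f : M → N} {v : M}
    (h : Manifold.IsSubmersionAt 𝓘(ℝ, E) 𝓘(ℝ, F) ∞ f v) :
    Function.Surjective (mapDeriv E F f v) := by
  obtain ⟨σ, hσv, hσ⟩ := h.exists_local_section
  have h1 := hσ.self_of_nhds.1.mdifferentiableAt (by simp)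
  have h2 : MDifferentiableAt 𝓘(ℝ, E) 𝓘(ℝ, F) f (σ (f v)) := by
    rw [hσv]
    exact h.contMDiffAt.mdifferentiableAt (by simp)
  have h3 := mfderiv_comp (f v) h2 h1
  have h4 : f ∘ σ =ᶠ[𝓝 (f v)] id := hσ.mono fun y hy => hy.2
  rw [h4.mfderiv_eq, mfderiv_id] at h3
  intro w
  refine ⟨mapDeriv F E σ (f v) w, ?_⟩
  have h5 : w = mapDeriv E F f (σ (f v)) (mapDeriv F E σ (f v) w) := DFunLike.congr_fun h3 w
  rw [hσv] at h5
  exact h5.symm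

variable [IsManifold 𝓘(ℝ, E) ∞ M] [IsManifold 𝓘(ℝ, F) ∞ N]

/-- The expression in charts of a submersion is a submersion. -/
theorem Manifold.IsSubmersionAt.fderiv_inCharts_surjective {f : M → N} {x : M} {y : N} {z : M}
    (h : Manifold.IsSubmersionAt 𝓘(ℝ, E) 𝓘(ℝ, F) ∞ f z) (hz : z ∈ (chartAt E x).source)
    (hfz : f z ∈ (chartAt F y).source) :
    Function.Surjective (fderiv ℝ (inCharts E F x y f) (chartAt E x z)) := by
  intro w
  obtain ⟨v, hv⟩ := h.mapDeriv_surjective (chartSymmDeriv F y (chartAt F y (f z)) w)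
  refine ⟨chartDeriv E x z v, ?_⟩
  rw [fderiv_inCharts hz h.contMDiffAt hfz, hv, chartDeriv_chartSymmDeriv hfz]

/-- Local diffeomorphisms are submersions. -/
theorem isSubmersionAtOfComplement_of_openPartialHomeomorph
    {M' : Type*} [TopologicalSpace M'] [ChartedSpace E M'] [IsManifold 𝓘(ℝ, E) ∞ M']
    (e : OpenPartialHomeomorph M M') (he : ContMDiffOn 𝓘(ℝ, E) 𝓘(ℝ, E) ∞ e e.source)
    (he' : ContMDiffOn 𝓘(ℝ, E) 𝓘(ℝ, E) ∞ e.symm e.target) {x : M} (hx : x ∈ e.source)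
    {f : M → M'} (hf : Set.EqOn f e e.source) :
    Manifold.IsSubmersionAtOfComplement PUnit.{1} 𝓘(ℝ, E) 𝓘(ℝ, E) ∞ f x := by
  let ψ := chartAt E (e x)
  have hψ : ContMDiffOn 𝓘(ℝ, E) 𝓘(ℝ, E) ∞ ψ ψ.source := contMDiffOn_chart
  have hψ' : ContMDiffOn 𝓘(ℝ, E) 𝓘(ℝ, E) ∞ ψ.symm ψ.target := contMDiffOn_chart_symm
  have hc : ContinuousAt f x := (e.continuousAt hx).congr
    (Filter.eventuallyEq_of_mem (e.open_source.mem_nhds hx) hf).symm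
  -- Transporting the target chart `ψ` through `e` makes the local expression of `f` the identity,
  -- with trivial complement.
  refine Manifold.IsSubmersionAtOfComplement.mk_of_continuousAt hc
    (ContinuousLinearEquiv.prodUnique ℝ E PUnit.{1}).symm (e.trans ψ) ψ ?_ ?_ ?_
    (IsManifold.chart_mem_maximalAtlas _) ?_
  · simpa using ⟨hx, mem_chart_source E (e x)⟩
  · rw [hf hx]
    exact mem_chart_source E (e x)
  · rw [IsManifold.mem_maximalAtlas_iff_contMDiffOn]
    constructor
    · have h1 : ContMDiffOn 𝓘(ℝ, E) 𝓘(ℝ, E) ∞ (ψ ∘ e) (e.source ∩ e ⁻¹' ψ.source) :=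
        hψ.comp (he.mono Set.inter_subset_left) (fun z hz => hz.2)
      simpa using h1
    · have h1 : ContMDiffOn 𝓘(ℝ, E) 𝓘(ℝ, E) ∞ (e.symm ∘ ψ.symm)
          (ψ.target ∩ ψ.symm ⁻¹' e.target) :=
        he'.comp (hψ'.mono Set.inter_subset_left) (fun z hz => hz.2)
      simpa [OpenPartialHomeomorph.trans_target] using h1
  · intro u hu
    have hu' : u ∈ ψ.target ∩ ψ.symm ⁻¹' e.target := by
      simpa [OpenPartialHomeomorph.trans_target] using hu
    have h1 : f (e.symm (ψ.symm u)) = ψ.symm u := by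
      rw [hf (e.map_target hu'.2), e.right_inv hu'.2]
    simp [h1, ψ.right_inv hu'.1]

end Submersions

theorem fderiv_inCharts_fieldInChart {E : Type*} [NormedAddCommGroup E] [NormedSpace ℝ E]
    {M : Type*} [TopologicalSpace M] [ChartedSpace E M] [IsManifold 𝓘(ℝ, E) ∞ M]
    {F : Type*} [NormedAddCommGroup F] [NormedSpace ℝ F]
    {N : Type*} [TopologicalSpace N] [ChartedSpace F N] [IsManifold 𝓘(ℝ, F) ∞ N]
    {x : M} {y : N} {f : M → N} {u : E} (hu : u ∈ (chartAt E x).target)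
    (hf : ContMDiffAt 𝓘(ℝ, E) 𝓘(ℝ, F) ∞ f ((chartAt E x).symm u))
    (hfu : f ((chartAt E x).symm u) ∈ (chartAt F y).source) (Z : M → E) :
    fderiv ℝ (inCharts E F x y f) u (fieldInChart E x Z u) =
      chartDeriv F y (f ((chartAt E x).symm u))
        (mapDeriv E F f ((chartAt E x).symm u) (Z ((chartAt E x).symm u))) := by
  have h := fderiv_inCharts ((chartAt E x).map_target hu) hf hfu (Z ((chartAt E x).symm u))
  rwa [(chartAt E x).right_inv hu] at h

/-! ### Germs of diffeomorphisms preserving both maps -/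

section LocallyRelated

variable {d : ℕ} {W : Type u} [TopologicalSpace W] [ChartedSpace (EuclideanSpace ℝ (Fin d)) W]
  {M N : Type*}

/-- There is a germ of diffeomorphism of `W` that preserves `p` and `q` and sends `a` to `b`. -/
def LocallyRelated (d : ℕ) {W : Type*} [TopologicalSpace W]
    [ChartedSpace (EuclideanSpace ℝ (Fin d)) W] {M N : Type*} (p : W → M) (q : W → N)
    (a b : W) : Prop :=
  ∃ e : OpenPartialHomeomorph W W, a ∈ e.source ∧ e a = b ∧
    ContMDiffOn (𝓡 d) (𝓡 d) ∞ e e.source ∧ ContMDiffOn (𝓡 d) (𝓡 d) ∞ e.symm e.target ∧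
    ∀ z ∈ e.source, p (e z) = p z ∧ q (e z) = q z

theorem LocallyRelated.refl (p : W → M) (q : W → N) (a : W) : LocallyRelated d p q a a :=
  ⟨OpenPartialHomeomorph.refl W, trivial, rfl, contMDiffOn_id, contMDiffOn_id,
    fun _ _ => ⟨rfl, rfl⟩⟩

theorem LocallyRelated.symm {p : W → M} {q : W → N} {a b : W} (h : LocallyRelated d p q a b) :
    LocallyRelated d p q b a := by
  obtain ⟨e, ha, rfl, h1, h2, h3⟩ := h
  refine ⟨e.symm, e.map_source ha, e.left_inv ha, h2, h1, fun z hz => ?_⟩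
  have := h3 _ (e.map_target hz)
  rw [e.right_inv hz] at this
  exact ⟨this.1.symm, this.2.symm⟩

theorem LocallyRelated.trans {p : W → M} {q : W → N} {a b c : W}
    (h : LocallyRelated d p q a b) (h' : LocallyRelated d p q b c) :
    LocallyRelated d p q a c := by
  obtain ⟨e, ha, rfl, h1, h2, h3⟩ := h
  obtain ⟨e', hb, rfl, h1', h2', h3'⟩ := h'
  refine ⟨e.trans e', ?_, rfl, ?_, ?_, fun z hz => ?_⟩
  · rw [OpenPartialHomeomorph.trans_source]
    exact ⟨ha, hb⟩
  · rw [OpenPartialHomeomorph.trans_source]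
    exact h1'.comp (h1.mono Set.inter_subset_left) fun z hz => hz.2
  · rw [OpenPartialHomeomorph.trans_target]
    exact h2.comp (h2'.mono Set.inter_subset_left) fun z hz => hz.2
  · rw [OpenPartialHomeomorph.trans_source] at hz
    have h4 := h3' _ hz.2
    have h5 := h3 _ hz.1
    exact ⟨h4.1.trans h5.1, h4.2.trans h5.2⟩

/-- The graph of the germ is a relation: `V` is the domain of `e`, `δ` is its inclusion and `η` is
`e`. -/
theorem LocallyRelated.equivalentPoints [IsManifold (𝓡 d) ∞ W] [T2Space W]
    [SecondCountableTopology W] {p : W → M} {q : W → N} {a b : W}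
    (h : LocallyRelated d p q a b) : EquivalentPoints (d := d) (d' := d) p q p q a b := by
  obtain ⟨e, ha, rfl, h1, h2, h3⟩ := h
  let U : Opens W := ⟨e.source, e.open_source⟩
  let j := U.openPartialHomeomorphSubtypeCoe ⟨⟨a, ha⟩⟩
  have hj : ContMDiffOn (𝓡 d) (𝓡 d) ∞ j j.source := contMDiff_subtype_val.contMDiffOn
  have hjt : j.target = e.source := U.openPartialHomeomorphSubtypeCoe_target _
  have hj' : ContMDiffOn (𝓡 d) (𝓡 d) ∞ j.symm j.target := by
    intro z hz
    have hzU : z ∈ U := by rwa [hjt] at hz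
    have h4 : ContMDiffAt (𝓡 d) (𝓡 d) ∞ (fun y : U => j.symm y) ⟨z, hzU⟩ := by
      have : (fun y : U => j.symm y) = id := funext fun y => j.left_inv trivial
      rw [this]
      exact contMDiffAt_id
    exact (contMDiffAt_subtype_iff.1 h4).contMDiffWithinAt
  have hje : ContMDiffOn (𝓡 d) (𝓡 d) ∞ (j.trans e) (j.trans e).source := by
    rw [OpenPartialHomeomorph.trans_source]
    exact h1.comp (hj.mono Set.inter_subset_left) fun z hz => hz.2
  have hje' : ContMDiffOn (𝓡 d) (𝓡 d) ∞ (j.trans e).symm (j.trans e).target := by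
    rw [OpenPartialHomeomorph.trans_target]
    exact hj'.comp (h2.mono Set.inter_subset_left) fun z hz => hz.2
  refine ⟨U, ⟨e.target, e.open_target⟩, d, U, inferInstance, inferInstance, inferInstance,
    inferInstance, inferInstance, Subtype.val, fun z => e z, ha, e.map_source ha, ?_,
    ⟨a, ha⟩, rfl, rfl⟩
  refine ⟨?_, ?_, Subtype.range_coe, ?_, fun v => (h3 v v.2).1.symm, fun v => (h3 v v.2).2.symm⟩
  · exact Manifold.IsSubmersionOfComplement.isSubmersion fun z =>
      isSubmersionAtOfComplement_of_openPartialHomeomorph j hj hj' (x := z) trivial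
        fun _ _ => rfl
  · exact Manifold.IsSubmersionOfComplement.isSubmersion fun z =>
      isSubmersionAtOfComplement_of_openPartialHomeomorph (j.trans e) hje hje' (x := z)
        (by
          rw [OpenPartialHomeomorph.trans_source]
          exact ⟨trivial, z.2⟩) fun _ _ => rfl
  · ext y
    constructor
    · rintro ⟨z, rfl⟩
      exact e.map_source z.2
    · intro hy
      exact ⟨⟨e.symm y, e.map_target hy⟩, e.right_inv hy⟩

end LocallyRelated

/-! ### From leaves to equivalence -/

section Leaves

variable {d m n : ℕ}
  {W : Type*} [TopologicalSpace W] [ChartedSpace (EuclideanSpace ℝ (Fin d)) W]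
  [IsManifold (𝓡 d) ∞ W]
  {M : Type*} [TopologicalSpace M] [ChartedSpace (EuclideanSpace ℝ (Fin m)) M]
  [IsManifold (𝓡 m) ∞ M]
  {N : Type*} [TopologicalSpace N] [ChartedSpace (EuclideanSpace ℝ (Fin n)) N]
  [IsManifold (𝓡 n) ∞ N]

/-- A map whose derivative vanishes on `Z` is constant along curves that solve, in a chart, the
differential equation of a multiple of `Z`. -/
theorem eq_of_chart_curve {p : W → M} (hp : ContMDiff (𝓡 d) (𝓡 m) ∞ p)
    {Z : W → EuclideanSpace ℝ (Fin d)} {U : Set W}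
    (hZ : ∀ z ∈ U, mapDeriv _ (EuclideanSpace ℝ (Fin m)) p z (Z z) = 0) {x : W} {y : M}
    {c : ℝ → EuclideanSpace ℝ (Fin d)} {ε : ℝ}
    (hc : ∀ s ∈ Set.Icc (0 : ℝ) 1, (c s ∈ (chartAt _ x).target ∧ (chartAt _ x).symm (c s) ∈ U ∧
      p ((chartAt _ x).symm (c s)) ∈ (chartAt (EuclideanSpace ℝ (Fin m)) y).source) ∧
      HasDerivAt c (ε • fieldInChart _ x Z (c s)) s) :
    p ((chartAt _ x).symm (c 1)) = p ((chartAt _ x).symm (c 0)) := by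
  have h0 := hc 0 (by simp)
  have h1 := hc 1 (by simp)
  refine (chartAt (EuclideanSpace ℝ (Fin m)) y).injOn h1.1.2.2 h0.1.2.2 ?_
  refine eq_of_fderiv_eq_zero_along (f := inCharts _ (EuclideanSpace ℝ (Fin m)) x y p)
    (c := c) (fun s hs => (hc s hs).2) (fun s hs => ?_) (by simp)
  obtain ⟨⟨ht, hU, hs'⟩, -⟩ := hc s hs
  constructor
  · have := contDiffAt_inCharts ((chartAt _ x).map_target ht) hp.contMDiffAt hs'
    rw [(chartAt _ x).right_inv ht] at this
    exact this.differentiableAt (by simp)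
  · rw [map_smul, fderiv_inCharts_fieldInChart ht hp.contMDiffAt hs', hZ _ hU, map_zero, smul_zero]

/-- In the chart at `γ t₀`, the flow of `Z` for the signed time `t - t₀` is a local diffeomorphism.
It preserves `p` and `q` because `Z` is tangent to their fibres, and it reaches `γ t` by uniqueness
of integral curves. -/
theorem eventually_locallyRelated_of_integralCurve {p : W → M} {q : W → N}
    (hp : ContMDiff (𝓡 d) (𝓡 m) ∞ p) (hq : ContMDiff (𝓡 d) (𝓡 n) ∞ q) {U : Opens W}
    {Z : VField d W} (hZ : Z ∈ biVerticalFields (m := m) (n := n) p q U) {γ : ℝ → W} {T : ℝ}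
    (hγU : ∀ t ∈ Set.Icc 0 T, γ t ∈ U)
    (hγ : IsMIntegralCurveOn (I := 𝓡 d) γ Z (Set.Icc 0 T)) {t₀ : ℝ} (ht₀ : t₀ ∈ Set.Icc 0 T) :
    ∀ᶠ t in 𝓝[Set.Icc 0 T] t₀, LocallyRelated d p q (γ t₀) (γ t) := by
  let E := EuclideanSpace ℝ (Fin d)
  let φ : OpenPartialHomeomorph W E := chartAt E (γ t₀)
  let ψ := chartAt (EuclideanSpace ℝ (Fin m)) (p (γ t₀))
  let χ := chartAt (EuclideanSpace ℝ (Fin n)) (q (γ t₀))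
  have hxφ : γ t₀ ∈ φ.source := mem_chart_source E (γ t₀)
  let S : Set E := {u | u ∈ φ.target ∧ φ.symm u ∈ U ∧ p (φ.symm u) ∈ ψ.source ∧
    q (φ.symm u) ∈ χ.source}
  have hS : S ∈ 𝓝 (φ (γ t₀)) := by
    have hc : ContinuousAt φ.symm (φ (γ t₀)) := φ.continuousAt_symm (φ.map_source hxφ)
    have h0 : φ.symm (φ (γ t₀)) = γ t₀ := φ.left_inv hxφ
    have hev : ∀ᶠ z in 𝓝 (φ.symm (φ (γ t₀))), z ∈ U ∧ p z ∈ ψ.source ∧ q z ∈ χ.source := by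
      rw [h0]
      filter_upwards [U.isOpen.mem_nhds (hγU t₀ ht₀),
        hp.continuous.continuousAt.preimage_mem_nhds
          (ψ.open_source.mem_nhds (mem_chart_source _ _)),
        hq.continuous.continuousAt.preimage_mem_nhds
          (χ.open_source.mem_nhds (mem_chart_source _ _))] with z h1 h2 h3
      exact ⟨h1, h2, h3⟩
    filter_upwards [φ.open_target.mem_nhds (φ.map_source hxφ), hc.eventually hev] with u h1 h2
    exact ⟨h1, h2⟩
  have hsm : ∀ᶠ u in 𝓝 (φ (γ t₀)), ContDiffAt ℝ ∞ (fieldInChart E (γ t₀) Z) u := by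
    filter_upwards [hS] with u hu
    have := contDiffAt_fieldInChart (E := E) (φ.map_target hu.1)
      (hZ.1.1.contMDiffAt (U.isOpen.mem_nhds hu.2.1))
    rwa [φ.right_inv hu.1] at this
  obtain ⟨S', hS', hflow⟩ := exists_flow_diffeo hsm hS
  have hγc : ContinuousWithinAt γ (Set.Icc 0 T) t₀ := (hγ t₀ ht₀).continuousWithinAt
  have hnear : ∀ᶠ t in 𝓝[Set.Icc 0 T] t₀, γ t ∈ φ.source ∧ φ (γ t) ∈ S' :=
    hγc.eventually (Filter.inter_mem (φ.open_source.mem_nhds hxφ)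
      ((φ.continuousAt hxφ).preimage_mem_nhds hS'))
  obtain ⟨r, hr, hrS⟩ := Metric.mem_nhdsWithin_iff.1 hnear
  have hsub : Filter.Tendsto (fun t : ℝ => t - t₀) (𝓝 t₀) (𝓝 0) := by
    have : ContinuousAt (fun t : ℝ => t - t₀) t₀ := by fun_prop
    simpa [ContinuousAt] using this
  have hflow' := hsub.eventually hflow
  filter_upwards [nhdsWithin_le_nhds hflow', self_mem_nhdsWithin,
    nhdsWithin_le_nhds (Metric.ball_mem_nhds t₀ hr)] with t ht htT htr
  obtain ⟨f, hf0, hf, hfs, huniq⟩ := ht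
  have hseg : ∀ s ∈ Set.Icc (0 : ℝ) 1, (t - t₀) * s + t₀ ∈ Set.Icc 0 T ∧
      (t - t₀) * s + t₀ ∈ Metric.ball t₀ r := by
    intro s hs
    have h1 : (t - t₀) * s + t₀ = (1 - s) • t₀ + s • t := by
      simp only [smul_eq_mul]
      ring
    rw [h1]
    exact ⟨convex_Icc 0 T ht₀ htT (by linarith [hs.2]) hs.1 (by ring),
      convex_ball t₀ r (Metric.mem_ball_self hr) htr (by linarith [hs.2]) hs.1 (by ring)⟩
  -- The affine substitution `s ↦ (t - t₀) * s + t₀` turns the piece of `γ` between `t₀` and `t`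
  -- into an orbit of `(t - t₀) • Z` over `[0, 1]`, also when `t < t₀`.
  have hend : φ (γ t) = f (φ (γ t₀)) := by
    have := huniq (fun s => φ (γ ((t - t₀) * s + t₀))) (by simp) (fun s hs => by
      obtain ⟨h1, h2⟩ := hrS ⟨(hseg s hs).2, (hseg s hs).1⟩
      refine ⟨h2, ?_⟩
      have h3 := hasDerivWithinAt_chartAt_comp (hγ _ (hseg s hs).1) h1
      have h4 : HasDerivWithinAt (fun s : ℝ => (t - t₀) * s + t₀) (t - t₀) (Set.Icc 0 1) s := by
        simpa using (((hasDerivAt_id s).const_mul (t - t₀)).add_const t₀).hasDerivWithinAt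
      have h5 := HasDerivWithinAt.scomp s h3 h4 (fun r hr => (hseg r hr).1)
      have h6 : fieldInChart E (γ t₀) Z (φ (γ ((t - t₀) * s + t₀))) = _ :=
        fieldInChart_apply h1 Z
      exact h5.congr_deriv (congrArg (fun v : E => (t - t₀) • v) h6.symm))
    simpa using this
  refine ⟨(φ.trans f).trans φ.symm, ?_, ?_, ?_, ?_, fun z hz => ?_⟩
  · simp only [OpenPartialHomeomorph.trans_source, OpenPartialHomeomorph.symm_source]
    refine ⟨⟨hxφ, hf0⟩, ?_⟩
    change f (φ (γ t₀)) ∈ φ.target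
    rw [← hend]
    exact φ.map_source (hrS ⟨htr, htT⟩).1
  · change φ.symm (f (φ (γ t₀))) = γ t
    rw [← hend, φ.left_inv (hrS ⟨htr, htT⟩).1]
  · intro z hz
    simp only [OpenPartialHomeomorph.trans_source, OpenPartialHomeomorph.symm_source] at hz
    obtain ⟨⟨hz1, hz2⟩, hz3⟩ := hz
    refine ContMDiffAt.contMDiffWithinAt ?_
    have h1 : ContMDiffAt (𝓡 d) (𝓡 d) ∞ (f ∘ φ) z :=
      ((hf _ hz2).1.contMDiffAt).comp z (contMDiffAt_chartAt hz1)
    exact ContMDiffAt.comp (g := φ.symm) z (contMDiffAt_chartAt_symm hz3) h1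
  · intro z hz
    simp only [OpenPartialHomeomorph.trans_target, OpenPartialHomeomorph.symm_target] at hz
    obtain ⟨hz1, hz2, hz3⟩ := hz
    refine ContMDiffAt.contMDiffWithinAt ?_
    have h1 : ContMDiffAt (𝓡 d) (𝓡 d) ∞ (f.symm ∘ φ) z :=
      ((hfs _ hz2).contMDiffAt).comp z (contMDiffAt_chartAt hz1)
    exact ContMDiffAt.comp (g := φ.symm) z (contMDiffAt_chartAt_symm hz3) h1
  · simp only [OpenPartialHomeomorph.trans_source, OpenPartialHomeomorph.symm_source] at hz
    obtain ⟨⟨hz1, hz2⟩, hz3⟩ := hz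
    obtain ⟨-, c, hc0, hc1, hc⟩ := hf _ hz2
    have h1 := eq_of_chart_curve hp hZ.1.2 (y := p (γ t₀)) (c := c)
      (fun s hs => ⟨⟨(hc s hs).1.1, (hc s hs).1.2.1, (hc s hs).1.2.2.1⟩, (hc s hs).2⟩)
    have h2 := eq_of_chart_curve hq hZ.2.2 (y := q (γ t₀)) (c := c)
      (fun s hs => ⟨⟨(hc s hs).1.1, (hc s hs).1.2.1, (hc s hs).1.2.2.2⟩, (hc s hs).2⟩)
    rw [hc1, hc0] at h1 h2
    have h3 : φ.symm (φ z) = z := φ.left_inv hz1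
    exact ⟨h1.trans (congrArg p h3), h2.trans (congrArg q h3)⟩

theorem locallyRelated_of_sameLeaf {p : W → M} {q : W → N}
    (hp : ContMDiff (𝓡 d) (𝓡 m) ∞ p) (hq : ContMDiff (𝓡 d) (𝓡 n) ∞ q) {a b : W}
    (h : SameLeaf (biVerticalFields (d := d) (m := m) (n := n) p q) a b) :
    LocallyRelated d p q a b := by
  induction h with
  | rel a b h =>
    obtain ⟨U, Z, γ, T, hZ, hT, rfl, rfl, hU, hγ⟩ := h
    -- An equivalence relation between times that holds locally holds on the whole connected
    -- interval.
    exact isPreconnected_Icc.induction₂ (fun s t => LocallyRelated d p q (γ s) (γ t))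
      (fun t ht => eventually_locallyRelated_of_integralCurve hp hq hZ hU hγ ht)
      (fun _ _ _ _ _ _ h1 h2 => h1.trans h2) (fun _ _ _ _ h => h.symm)
      (Set.left_mem_Icc.2 hT) (Set.right_mem_Icc.2 hT)
  | refl a => exact LocallyRelated.refl p q a
  | symm a b _ ih => exact ih.symm
  | trans a b c _ _ ih1 ih2 => exact ih1.trans ih2

end Leaves

/-! ### Lifting and extending vector fields along submersions -/

/-- The derivative of a submersion has a smooth right inverse. -/
theorem exists_smooth_rightInverse {E F : Type*} [NormedAddCommGroup E] [NormedSpace ℝ E]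
    [FiniteDimensional ℝ E] [NormedAddCommGroup F] [NormedSpace ℝ F] [FiniteDimensional ℝ F]
    {f : E → F} {x₀ : E} (hf : ∀ᶠ y in 𝓝 x₀, ContDiffAt ℝ ∞ f y)
    (hs : Function.Surjective (fderiv ℝ f x₀)) :
    ∃ R : E → F →L[ℝ] E, ∀ᶠ z in 𝓝 x₀, ContDiffAt ℝ ∞ R z ∧ ∀ w, fderiv ℝ f z (R z w) = w := by
  obtain ⟨R₀, hR₀⟩ := (fderiv ℝ f x₀).toLinearMap.exists_rightInverse_of_surjective
    (LinearMap.range_eq_top.2 hs)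
  have : CompleteSpace F := FiniteDimensional.complete ℝ F
  let L : F →L[ℝ] E := LinearMap.toContinuousLinearMap R₀
  let A : E → F →L[ℝ] F := fun z => (fderiv ℝ f z).comp L
  have hA : ∀ z, ContDiffAt ℝ ∞ f z → ContDiffAt ℝ ∞ A z := fun z hz =>
    (hz.fderiv_right (m := ∞) (by simp)).clm_comp contDiffAt_const
  have hA₀ : A x₀ = ContinuousLinearEquiv.refl ℝ F := by
    ext w
    exact DFunLike.congr_fun hR₀ w
  have hnear : ∀ᶠ z in 𝓝 x₀, A z ∈ Set.range ((↑) : (F ≃L[ℝ] F) → F →L[ℝ] F) := by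
    refine (hA x₀ hf.self_of_nhds).continuousAt.preimage_mem_nhds ?_
    rw [hA₀]
    exact ContinuousLinearEquiv.nhds _
  -- A fixed right inverse `L` at `x₀` is corrected by the inverse of `A z`, which is near the
  -- identity and depends smoothly on `z`.
  refine ⟨fun z => L.comp (A z).inverse, ?_⟩
  filter_upwards [hf, hnear] with z hz ⟨e, he⟩
  constructor
  · refine contDiffAt_const.clm_comp (ContDiffAt.comp
      (g := ContinuousLinearMap.inverse) z ?_ (hA z hz))
    rw [← he]
    exact contDiffAt_map_inverse e
  · intro w
    have h1 : A z ((A z).inverse w) = w := by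
      rw [← he, ContinuousLinearMap.inverse_equiv]
      exact e.apply_symm_apply w
    exact h1

theorem eventually_nhds_chartAt {H W : Type*} [TopologicalSpace H] [TopologicalSpace W]
    [ChartedSpace H W] {x w : W} (hw : w ∈ (chartAt H x).source) {P : H → Prop} :
    (∀ᶠ u in 𝓝 (chartAt H x w), P u) ↔ ∀ᶠ z in 𝓝 w, P (chartAt H x z) := by
  rw [← (chartAt H x).map_nhds_eq hw, Filter.eventually_map]

section Lifts

variable {E : Type*} [NormedAddCommGroup E] [NormedSpace ℝ E]
  {W : Type*} [TopologicalSpace W] [ChartedSpace E W] [IsManifold 𝓘(ℝ, E) ∞ W]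
  {F : Type*} [NormedAddCommGroup F] [NormedSpace ℝ F]
  {N : Type*} [TopologicalSpace N] [ChartedSpace F N] [IsManifold 𝓘(ℝ, F) ∞ N]

theorem eventually_contDiffAt_inCharts {q : W → N} (hq : ContMDiff 𝓘(ℝ, E) 𝓘(ℝ, F) ∞ q) (x : W) :
    ∀ᶠ z in 𝓝 x, z ∈ (chartAt E x).source ∧ q z ∈ (chartAt F (q x)).source ∧
      ContDiffAt ℝ ∞ (inCharts E F x (q x) q) (chartAt E x z) := by
  filter_upwards [(chartAt E x).open_source.mem_nhds (mem_chart_source E x),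
    hq.continuous.continuousAt.preimage_mem_nhds
      ((chartAt F (q x)).open_source.mem_nhds (mem_chart_source F (q x)))] with z h1 h2
  exact ⟨h1, h2, contDiffAt_inCharts h1 hq.contMDiffAt h2⟩

variable [FiniteDimensional ℝ E] [FiniteDimensional ℝ F]

theorem exists_smooth_rightInverse_inCharts {q : W → N}
    (hq : Manifold.IsSubmersion 𝓘(ℝ, E) 𝓘(ℝ, F) ∞ q) (x : W) :
    ∃ R : E → F →L[ℝ] E, ∀ᶠ z in 𝓝 x, ContDiffAt ℝ ∞ R (chartAt E x z) ∧
      ∀ w, fderiv ℝ (inCharts E F x (q x) q) (chartAt E x z) (R (chartAt E x z) w) = w := by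
  obtain ⟨R, hR⟩ := exists_smooth_rightInverse
    ((eventually_nhds_chartAt (mem_chart_source E x)).2 ((eventually_contDiffAt_inCharts hq.contMDiff x).mono
      fun z hz => hz.2.2))
    ((hq.isSubmersionAt x).fderiv_inCharts_surjective (mem_chart_source E x)
      (mem_chart_source F (q x)))
  exact ⟨R, (eventually_nhds_chartAt (mem_chart_source E x)).1 hR⟩

/-- Vector fields can be lifted along submersions. -/
theorem exists_field_lift {q : W → N} (hq : Manifold.IsSubmersion 𝓘(ℝ, E) 𝓘(ℝ, F) ∞ q) {x : W}
    {X : N → F} (hX : ∀ᶠ y in 𝓝 (q x), FieldSmoothAt F X y) :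
    ∃ Y : W → E, ∀ᶠ z in 𝓝 x, FieldSmoothAt E Y z ∧ mapDeriv E F q z (Y z) = X (q z) := by
  have : CompleteSpace E := FiniteDimensional.complete ℝ E
  have : CompleteSpace F := FiniteDimensional.complete ℝ F
  obtain ⟨R, hR⟩ := exists_smooth_rightInverse_inCharts hq x
  refine ⟨fieldOfChart E x fun u =>
    R u (fieldInChart F (q x) X (inCharts E F x (q x) q u)), ?_⟩
  filter_upwards [hR, eventually_contDiffAt_inCharts hq.contMDiff x,
    hq.contMDiff.continuous.continuousAt.eventually hX] with z ⟨h1, h2⟩ ⟨h3, h4, h5⟩ h6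
  have h7 : inCharts E F x (q x) q (chartAt E x z) = chartAt F (q x) (q z) := by
    rw [inCharts, (chartAt E x).left_inv h3]
  constructor
  · refine contMDiffAt_fieldOfChart h3 (h1.clm_apply ?_)
    refine ContDiffAt.comp (g := fieldInChart F (q x) X) _ ?_ h5
    rw [h7]
    exact contDiffAt_fieldInChart h4 h6
  · refine chartDeriv_injective h4 ?_
    rw [← fderiv_inCharts h3 hq.contMDiff.contMDiffAt h4, chartDeriv_fieldOfChart h3, h2, h7,
      fieldInChart_apply h4]

/-- Vectors tangent to the fibres of a submersion extend to vector fields that are tangent to the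
fibres. -/
theorem exists_vertical_extension {p : W → N}
    (hp : Manifold.IsSubmersion 𝓘(ℝ, E) 𝓘(ℝ, F) ∞ p) {x : W} {v : E}
    (hv : mapDeriv E F p x v = 0) :
    ∃ Z : W → E, Z x = v ∧ ∀ᶠ z in 𝓝 x, FieldSmoothAt E Z z ∧ mapDeriv E F p z (Z z) = 0 := by
  have : CompleteSpace E := FiniteDimensional.complete ℝ E
  obtain ⟨R, hR⟩ := exists_smooth_rightInverse_inCharts hp x
  have hx := mem_chart_source E x
  -- The constant extension in the chart, minus a lift of its image under the derivative of `p`. The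
  -- correction vanishes at `x` because `v` is vertical.
  refine ⟨fieldOfChart E x fun u => chartDeriv E x x v -
    R u (fderiv ℝ (inCharts E F x (p x) p) u (chartDeriv E x x v)), ?_, ?_⟩
  · refine chartDeriv_injective hx ?_
    rw [chartDeriv_fieldOfChart hx, fderiv_inCharts hx hp.contMDiff.contMDiffAt
      (mem_chart_source F (p x)), hv, map_zero, map_zero, sub_zero]
  · filter_upwards [hR, eventually_contDiffAt_inCharts hp.contMDiff x]
      with z ⟨h1, h2⟩ ⟨h3, h4, h5⟩
    constructor
    · refine contMDiffAt_fieldOfChart h3 (contDiffAt_const.sub (h1.clm_apply ?_))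
      exact (h5.fderiv_right (m := ∞) (by simp)).clm_apply contDiffAt_const
    · refine chartDeriv_injective h4 ?_
      rw [← fderiv_inCharts h3 hp.contMDiff.contMDiffAt h4, chartDeriv_fieldOfChart h3, map_sub,
        h2, sub_self, map_zero]

end Lifts

section FieldSmoothAt

variable {E : Type*} [NormedAddCommGroup E] [NormedSpace ℝ E]
  {W : Type*} [TopologicalSpace W] [ChartedSpace E W] [IsManifold 𝓘(ℝ, E) ∞ W]

theorem FieldSmoothAt.add {Y Z : W → E} {z : W} (hY : FieldSmoothAt E Y z)
    (hZ : FieldSmoothAt E Z z) : FieldSmoothAt E (fun z => Y z + Z z) z :=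
  ContMDiffAt.add_section (V := TangentSpace 𝓘(ℝ, E) (M := W)) hY hZ

theorem FieldSmoothAt.smul {f : W → ℝ} {Z : W → E} {z : W}
    (hf : ContMDiffAt 𝓘(ℝ, E) 𝓘(ℝ, ℝ) ∞ f z) (hZ : FieldSmoothAt E Z z) :
    FieldSmoothAt E (fun z => f z • Z z) z :=
  ContMDiffAt.smul_section (V := TangentSpace 𝓘(ℝ, E) (M := W)) hf hZ

theorem FieldSmoothAt.sum {ι : Type*} {s : Finset ι} {Z : ι → W → E} {z : W}
    (hZ : ∀ i ∈ s, FieldSmoothAt E (Z i) z) : FieldSmoothAt E (fun z => ∑ i ∈ s, Z i z) z :=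
  ContMDiffAt.sum_section (V := TangentSpace 𝓘(ℝ, E) (M := W)) hZ

end FieldSmoothAt

theorem exists_opens_of_eventually {X : Type*} [TopologicalSpace X] {x : X} {P : X → Prop}
    (h : ∀ᶠ z in 𝓝 x, P z) : ∃ V : Opens X, x ∈ V ∧ ∀ z ∈ V, P z := by
  obtain ⟨V, hV, hVo, hx⟩ := eventually_nhds_iff.1 h
  exact ⟨⟨V, hVo⟩, hx, hV⟩

/-! ### Projectable frames of the vertical bundle -/

section Projectable

variable {d m n : ℕ}
  {W : Type*} [TopologicalSpace W] [ChartedSpace (EuclideanSpace ℝ (Fin d)) W]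
  [IsManifold (𝓡 d) ∞ W]
  {M : Type*} [TopologicalSpace M] [ChartedSpace (EuclideanSpace ℝ (Fin m)) M]
  {N : Type*} [TopologicalSpace N] [ChartedSpace (EuclideanSpace ℝ (Fin n)) N]
  [IsManifold (𝓡 n) ∞ N]
  {FM : Opens M → Set (VField m M)} {FN : Opens N → Set (VField n N)} {p : W → M} {q : W → N}

theorem VField.SmoothOn.fieldSmoothAt {Z : VField d W} {U : Opens W} (h : Z.SmoothOn U) {z : W}
    (hz : z ∈ U) : FieldSmoothAt (EuclideanSpace ℝ (Fin d)) Z z :=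
  h.contMDiffAt (U.isOpen.mem_nhds hz)

/-- In a bi-submersion, sections of `FN` lift to fields that are tangent to the fibres of `p`. -/
theorem IsBiSubmersion.exists_vertical_lift (hW : IsBiSubmersion (d := d) FM FN p q)
    (hFN : IsVFieldSubsheaf FN) {x : W} {O : Opens N} (hx : q x ∈ O) {X : VField n N}
    (hX : X ∈ FN O) :
    ∃ ξ : W → EuclideanSpace ℝ (Fin d), ∀ᶠ z in 𝓝 x, FieldSmoothAt _ ξ z ∧
      mapDeriv _ (EuclideanSpace ℝ (Fin m)) p z (ξ z) = 0 ∧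
      mapDeriv _ (EuclideanSpace ℝ (Fin n)) q z (ξ z) = X (q z) := by
  have hXs : ∀ᶠ y in 𝓝 (q x), FieldSmoothAt (EuclideanSpace ℝ (Fin n)) X y := by
    filter_upwards [O.isOpen.mem_nhds hx] with y hy
    exact (hFN.smooth O X hX).fieldSmoothAt hy
  obtain ⟨Y, hY⟩ := exists_field_lift hW.submersion_right hXs
  obtain ⟨V, hxV, hV⟩ := exists_opens_of_eventually (hY.and
    (hW.submersion_right.contMDiff.continuous.continuousAt.preimage_mem_nhds
      (O.isOpen.mem_nhds hx)))
  have h1 : (Y : VField d W) ∈ pullbackFields (d := d) q FN V := by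
    refine ⟨fun z hz => (hV z hz).1.1.contMDiffWithinAt, fun z hz => ⟨V, le_rfl, hz, O,
      fun y hy => (hV y hy).2, 1, fun _ => X, fun _ _ => 1, fun _ => hX,
      fun _ => contMDiffOn_const, fun y hy => ?_⟩⟩
    rw [Fin.sum_univ_one, one_smul]
    exact (hV y hy).1.2
  -- The lift `Y` thus splits into a part in `ker Tp` and a part in `ker Tq`. Dropping the latter
  -- does not change the image under `q`.
  rw [← hW.pullback_eq, hW.pullback_eq_sum] at h1
  obtain ⟨ξ, hξ, ζ, hζ, hsum⟩ := h1
  refine ⟨ξ, ?_⟩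
  filter_upwards [V.isOpen.mem_nhds hxV] with z hz
  refine ⟨hξ.1.fieldSmoothAt hz, hξ.2 z hz, ?_⟩
  have h2 : mapDeriv _ (EuclideanSpace ℝ (Fin n)) q z (Y z) = X (q z) := (hV z hz).1.2
  have h3 : mapDeriv (EuclideanSpace ℝ (Fin d)) (EuclideanSpace ℝ (Fin n)) q z (ζ z) = 0 :=
    hζ.2 z hz
  have h4 : Y z = ξ z + ζ z := hsum z hz
  have h5 : mapDeriv (EuclideanSpace ℝ (Fin d)) (EuclideanSpace ℝ (Fin n)) q z (Y z) = _ :=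
    (congrArg _ h4).trans (map_add _ _ _)
  exact (h5.trans ((congrArg _ h3).trans (add_zero _))).symm.trans h2

variable [IsManifold (𝓡 m) ∞ M]

/-- In a bi-submersion, vectors tangent to the fibres of `p` extend to fields that are tangent to
the fibres of `p` and `q`-projectable. -/
theorem IsBiSubmersion.exists_projectable_extension (hW : IsBiSubmersion (d := d) FM FN p q)
    (hFN : IsVFieldSubsheaf FN) {x : W} {v : EuclideanSpace ℝ (Fin d)}
    (hv : mapDeriv _ (EuclideanSpace ℝ (Fin m)) p x v = 0) :
    ∃ (η : W → EuclideanSpace ℝ (Fin d)) (X : N → EuclideanSpace ℝ (Fin n)), η x = v ∧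
      (∀ᶠ y in 𝓝 (q x), FieldSmoothAt _ X y) ∧ ∀ᶠ z in 𝓝 x, FieldSmoothAt _ η z ∧
      mapDeriv _ (EuclideanSpace ℝ (Fin m)) p z (η z) = 0 ∧
      mapDeriv _ (EuclideanSpace ℝ (Fin n)) q z (η z) = X (q z) := by
  obtain ⟨Z, hZx, hZ⟩ := exists_vertical_extension hW.submersion_left hv
  obtain ⟨U, hxU, hU⟩ := exists_opens_of_eventually hZ
  have h1 : (Z : VField d W) ∈ verticalSumFields (d := d) (m := m) (n := n) p q U :=
    ⟨Z, ⟨fun z hz => (hU z hz).1.contMDiffWithinAt, fun z hz => (hU z hz).2⟩, 0,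
      ⟨(Bundle.contMDiff_zeroSection ℝ (TangentSpace (𝓡 d) (M := W))).contMDiffOn,
        fun z _ => map_zero _⟩, fun z _ => (add_zero _).symm⟩
  rw [← hW.pullback_eq_sum, hW.pullback_eq] at h1
  obtain ⟨V, -, hxV, O, hVO, r, X, f, hX, hf, hsum⟩ := h1.2 x hxU
  choose ξ hξ using fun i => hW.exists_vertical_lift hFN (hVO x hxV) (hX i)
  have hZq : ∀ z ∈ V, mapDeriv _ (EuclideanSpace ℝ (Fin n)) q z (Z z) =
      ∑ i, f i z • (X i (q z) : EuclideanSpace ℝ (Fin n)) := hsum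
  have hcomb : ∀ (z : W) (a : Fin r → EuclideanSpace ℝ (Fin n)),
      ∑ i, f i z • a i + ∑ i, (f i x - f i z) • a i = ∑ i, f i x • a i := fun z a => by
    simp only [← Finset.sum_add_distrib, ← add_smul, add_sub_cancel]
  -- The field `Z` projects to `X i` with coefficients `f i` that vary along the fibres of `q`.
  -- Adding vertical lifts freezes these coefficients at their values at `x`, keeps the field
  -- tangent to the fibres of `p`, and changes nothing at `x`.
  refine ⟨fun z => Z z + ∑ i, (f i x - f i z) • ξ i z,
    fun y => ∑ i, f i x • (X i y : EuclideanSpace ℝ (Fin n)), by simp [hZx], ?_, ?_⟩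
  · filter_upwards [O.isOpen.mem_nhds (hVO x hxV)] with y hy
    exact FieldSmoothAt.sum fun i _ => FieldSmoothAt.smul contMDiffAt_const
      ((hFN.smooth O _ (hX i)).fieldSmoothAt hy)
  · filter_upwards [hZ, V.isOpen.mem_nhds hxV, Filter.eventually_all.2 hξ] with z h2 hz h3
    refine ⟨h2.1.add (FieldSmoothAt.sum fun i _ => FieldSmoothAt.smul
      (contMDiffAt_const.sub ((hf i).contMDiffAt (V.isOpen.mem_nhds hz))) (h3 i).1), ?_, ?_⟩
    · simp [map_sum, h2.2, (h3 _).2.1]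
    · simp only [map_add, map_sum, map_smul, hZq z hz, (h3 _).2.2]
      exact hcomb z fun i => X i (q z)

end Projectable

section Frame

variable {d m n : ℕ}
  {W : Type*} [TopologicalSpace W] [ChartedSpace (EuclideanSpace ℝ (Fin d)) W]
  [IsManifold (𝓡 d) ∞ W]
  {M : Type*} [TopologicalSpace M] [ChartedSpace (EuclideanSpace ℝ (Fin m)) M]
  [IsManifold (𝓡 m) ∞ M]
  {N : Type*} [TopologicalSpace N] [ChartedSpace (EuclideanSpace ℝ (Fin n)) N]
  [IsManifold (𝓡 n) ∞ N]
  {FM : Opens M → Set (VField m M)} {FN : Opens N → Set (VField n N)} {p : W → M} {q : W → N}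

local notation "𝔼" => EuclideanSpace ℝ (Fin d)
local notation "𝔽" => EuclideanSpace ℝ (Fin m)
local notation "𝔾" => EuclideanSpace ℝ (Fin n)

/-- The expression in charts of `IsBiSubmersion.exists_projectable_extension`. -/
theorem IsBiSubmersion.exists_projectable_extension_inCharts
    (hW : IsBiSubmersion (d := d) FM FN p q) (hFN : IsVFieldSubsheaf FN) {x : W} {k : 𝔼}
    (hk : fderiv ℝ (inCharts 𝔼 𝔽 x (p x) p) (chartAt 𝔼 x x) k = 0) :
    ∃ (η : 𝔼 → 𝔼) (X : 𝔾 → 𝔾), η (chartAt 𝔼 x x) = k ∧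
      ContDiffAt ℝ ∞ X (chartAt 𝔾 (q x) (q x)) ∧
      ∀ᶠ u in 𝓝 (chartAt 𝔼 x x), ContDiffAt ℝ ∞ η u ∧
        fderiv ℝ (inCharts 𝔼 𝔽 x (p x) p) u (η u) = 0 ∧
        fderiv ℝ (inCharts 𝔼 𝔾 x (q x) q) u (η u) = X (inCharts 𝔼 𝔾 x (q x) q u) := by
  have hx := mem_chart_source 𝔼 x
  have hp := hW.submersion_left.contMDiff
  have hq := hW.submersion_right.contMDiff
  have hv : mapDeriv 𝔼 𝔽 p x (chartSymmDeriv 𝔼 x (chartAt 𝔼 x x) k) = 0 := by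
    refine chartDeriv_injective (mem_chart_source 𝔽 (p x)) ?_
    rw [← fderiv_inCharts hx hp.contMDiffAt (mem_chart_source 𝔽 (p x)),
      chartDeriv_chartSymmDeriv hx, hk, map_zero]
  obtain ⟨η, X, h1, h2, h3⟩ := hW.exists_projectable_extension hFN hv
  refine ⟨fieldInChart 𝔼 x η, fieldInChart 𝔾 (q x) X, ?_, ?_, ?_⟩
  · rw [fieldInChart_apply hx, h1, chartDeriv_chartSymmDeriv hx]
  · exact contDiffAt_fieldInChart (mem_chart_source 𝔾 (q x)) h2.self_of_nhds
  · rw [eventually_nhds_chartAt hx]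
    filter_upwards [h3, eventually_contDiffAt_inCharts hp x, eventually_contDiffAt_inCharts hq x]
      with z ⟨h4, h5, h6⟩ ⟨h7, h8, _⟩ ⟨_, h9, _⟩
    refine ⟨contDiffAt_fieldInChart h7 h4, ?_, ?_⟩
    · rw [fieldInChart_apply h7, fderiv_inCharts h7 hp.contMDiffAt h8, h5, map_zero]
    · rw [fieldInChart_apply h7, fderiv_inCharts h7 hq.contMDiffAt h9, h6, inCharts,
        (chartAt 𝔼 x).left_inv h7, fieldInChart_apply h9]

/-- In a bi-submersion, `ker Tp` has local frames that consist of `q`-projectable fields. -/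
theorem IsBiSubmersion.exists_projectable_frame
    (hW : IsBiSubmersion (d := d) FM FN p q) (hFN : IsVFieldSubsheaf FN) (x : W) :
    ∃ (ξ : 𝔼 → (fderiv ℝ (inCharts 𝔼 𝔽 x (p x) p) (chartAt 𝔼 x x)).ker →L[ℝ] 𝔼)
      (X : 𝔾 → (fderiv ℝ (inCharts 𝔼 𝔽 x (p x) p) (chartAt 𝔼 x x)).ker →L[ℝ] 𝔾),
      (∀ k, ξ (chartAt 𝔼 x x) k = k) ∧ ContDiffAt ℝ ∞ X (chartAt 𝔾 (q x) (q x)) ∧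
      ∀ᶠ u in 𝓝 (chartAt 𝔼 x x), ContDiffAt ℝ ∞ ξ u ∧ ∀ k,
        fderiv ℝ (inCharts 𝔼 𝔽 x (p x) p) u (ξ u k) = 0 ∧
        fderiv ℝ (inCharts 𝔼 𝔾 x (q x) q) u (ξ u k) = X (inCharts 𝔼 𝔾 x (q x) q u) k := by
  let K := (fderiv ℝ (inCharts 𝔼 𝔽 x (p x) p) (chartAt 𝔼 x x)).ker
  let b := Module.finBasis ℝ K
  choose η X hη hX h using fun j => hW.exists_projectable_extension_inCharts hFN
    (x := x) (k := b j) (b j).2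
  let β : Fin (Module.finrank ℝ K) → K →L[ℝ] ℝ := fun j => (b.coord j).toContinuousLinearMap
  have hβ : ∀ k : K, ∑ j, β j k • (b j : 𝔼) = k := fun k => by
    have h1 := congrArg (Subtype.val : K → 𝔼) (b.sum_repr k)
    rw [AddSubmonoidClass.coe_finsetSum] at h1
    exact h1
  refine ⟨fun u => ∑ j, (β j).smulRight (η j u), fun y => ∑ j, (β j).smulRight (X j y),
    fun k => ?_, ?_, ?_⟩
  · simp only [sum_apply, ContinuousLinearMap.smulRight_apply, hη]
    exact hβ k
  · exact ContDiffAt.sum fun j _ => contDiffAt_const.smulRight (hX j)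
  · filter_upwards [Filter.eventually_all.2 h] with u hu
    refine ⟨ContDiffAt.sum fun j _ => contDiffAt_const.smulRight (hu j).1, fun k => ⟨?_, ?_⟩⟩
    · simp [(hu _).2.1]
    · simp [(hu _).2.2]

end Frame

/-! ### From equivalence to leaves -/

/-- Conditions on the values of a smooth map that depend only on the image under a submersion `q`
descend along `q`. -/
theorem Manifold.IsSubmersion.exists_descent
    {E : Type*} [NormedAddCommGroup E] [NormedSpace ℝ E]
    {W : Type*} [TopologicalSpace W] [ChartedSpace E W] [IsManifold 𝓘(ℝ, E) ∞ W]
    {F : Type*} [NormedAddCommGroup F] [NormedSpace ℝ F]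
    {N : Type*} [TopologicalSpace N] [ChartedSpace F N] [IsManifold 𝓘(ℝ, F) ∞ N]
    {K : Type*} [NormedAddCommGroup K] [NormedSpace ℝ K]
    {q : W → N} (hq : Manifold.IsSubmersion 𝓘(ℝ, E) 𝓘(ℝ, F) ∞ q) {x w : W} {y₀ : N}
    (hw : w ∈ (chartAt E x).source) (hqw : q w ∈ (chartAt F y₀).source) {l : E → K}
    {B : F → K → Prop} (hl : ∀ᶠ u in 𝓝 (chartAt E x w), ContDiffAt ℝ ∞ l u ∧
      B (inCharts E F x y₀ q u) (l u)) :
    ∃ μ : F → K, μ (chartAt F y₀ (q w)) = l (chartAt E x w) ∧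
      ∀ᶠ y in 𝓝 (chartAt F y₀ (q w)), ContDiffAt ℝ ∞ μ y ∧ B y (μ y) := by
  obtain ⟨τ, hτw, hτ⟩ := (hq.isSubmersionAt w).exists_local_section
  have hval : ∀ y ∈ (chartAt F y₀).source,
      inCharts F E y₀ x τ (chartAt F y₀ y) = chartAt E x (τ y) := fun y hy => by
    rw [inCharts, (chartAt F y₀).left_inv hy]
  -- Composition with a section `τ` of `q` through `w`: since `q ∘ τ` is the identity, the condition
  -- at `τ y` is the condition at `y`.
  refine ⟨fun y => l (inCharts F E y₀ x τ y), by simp only [hval _ hqw, hτw], ?_⟩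
  rw [eventually_nhds_chartAt hqw]
  have hτc : Filter.Tendsto τ (𝓝 (q w)) (𝓝 w) := by
    have := hτ.self_of_nhds.1.continuousAt
    rwa [ContinuousAt, hτw] at this
  filter_upwards [hτ, (chartAt F y₀).open_source.mem_nhds hqw,
    hτc.eventually ((eventually_nhds_chartAt hw).1 hl),
    hτc.eventually ((chartAt E x).open_source.mem_nhds hw)] with y ⟨h1, h2⟩ h3 ⟨h4, h5⟩ h6
  have h7 : inCharts E F x y₀ q (chartAt E x (τ y)) = chartAt F y₀ y := by
    rw [inCharts, (chartAt E x).left_inv h6, h2]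
  rw [h7] at h5
  constructor
  · refine ContDiffAt.comp (g := l) _ ?_ (contDiffAt_inCharts h3 h1 h6)
    rwa [hval y h3]
  · rwa [hval y h3]

/-- Equivalent points are related by a germ of smooth map that preserves `p` and `q`. -/
theorem EquivalentPoints.exists_germ {d d' : ℕ}
    {W : Type u} [TopologicalSpace W] [ChartedSpace (EuclideanSpace ℝ (Fin d)) W]
    {W' : Type u} [TopologicalSpace W'] [ChartedSpace (EuclideanSpace ℝ (Fin d')) W']
    {M N : Type*} {p : W → M} {q : W → N} {p' : W' → M} {q' : W' → N} {w : W} {w' : W'}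
    (h : EquivalentPoints (d := d) (d' := d') p q p' q' w w') :
    ∃ g : W → W', g w = w' ∧ ∀ᶠ z in 𝓝 w, ContMDiffAt (𝓡 d) (𝓡 d') ∞ g z ∧
      p' (g z) = p z ∧ q' (g z) = q z := by
  obtain ⟨U, U', k, V, _, _, _, _, _, δ, η, -, -, h, v, rfl, rfl⟩ := h
  obtain ⟨σ, hσv, hσ⟩ := (h.submersion_left.isSubmersionAt v).exists_local_section
  refine ⟨η ∘ σ, congrArg η hσv, ?_⟩
  filter_upwards [hσ] with z ⟨h1, h2⟩
  refine ⟨h.submersion_right.contMDiff.contMDiffAt.comp z h1, ?_, ?_⟩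
  · rw [Function.comp_apply, ← h.comm_left, h2]
  · rw [Function.comp_apply, ← h.comm_right, h2]

section Leaves

variable {d m n : ℕ}
  {W : Type u} [TopologicalSpace W] [ChartedSpace (EuclideanSpace ℝ (Fin d)) W]
  [IsManifold (𝓡 d) ∞ W]
  {M : Type*} [TopologicalSpace M] [ChartedSpace (EuclideanSpace ℝ (Fin m)) M]
  [IsManifold (𝓡 m) ∞ M]
  {N : Type*} [TopologicalSpace N] [ChartedSpace (EuclideanSpace ℝ (Fin n)) N]
  [IsManifold (𝓡 n) ∞ N]
  {FM : Opens M → Set (VField m M)} {FN : Opens N → Set (VField n N)} {p : W → M} {q : W → N}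

local notation "𝔼" => EuclideanSpace ℝ (Fin d)
local notation "𝔽" => EuclideanSpace ℝ (Fin m)
local notation "𝔾" => EuclideanSpace ℝ (Fin n)

/-- Near any point of a bi-submersion, equivalent points are joined by an integral curve of a
bi-vertical vector field. -/
theorem IsBiSubmersion.exists_nhds_leafStep (hW : IsBiSubmersion (d := d) FM FN p q)
    (hFN : IsVFieldSubsheaf FN) (x : W) :
    ∃ U : Set W, IsOpen U ∧ x ∈ U ∧ ∀ w ∈ U, ∀ w' ∈ U,
      EquivalentPoints (d := d) (d' := d) p q p q w w' →
        LeafStep (biVerticalFields (d := d) (m := m) (n := n) p q) w w' := by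
  have hp := hW.submersion_left.contMDiff
  have hq := hW.submersion_right.contMDiff
  let φ := chartAt 𝔼 x
  let ψ := chartAt 𝔽 (p x)
  let χ := chartAt 𝔾 (q x)
  let P := inCharts 𝔼 𝔽 x (p x) p
  let Q := inCharts 𝔼 𝔾 x (q x) q
  have hxφ : x ∈ φ.source := mem_chart_source 𝔼 x
  have hP : ∀ z ∈ φ.source, P (φ z) = ψ (p z) := fun z hz =>
    congrArg (fun a => ψ (p a)) (φ.left_inv hz)
  have hQ : ∀ z ∈ φ.source, Q (φ z) = χ (q z) := fun z hz =>
    congrArg (fun a => χ (q a)) (φ.left_inv hz)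
  obtain ⟨ξ, X, hξx, hX, hξ⟩ := hW.exists_projectable_frame hFN x
  have hpx := (eventually_nhds_chartAt hxφ (P := fun u => u ∈ φ.target ∧
      p (φ.symm u) ∈ ψ.source ∧ ContDiffAt ℝ ∞ P u)).2 <| by
    filter_upwards [eventually_contDiffAt_inCharts hp x] with z ⟨h1, h2, h3⟩
    refine ⟨φ.map_source h1, ?_, h3⟩
    rwa [φ.left_inv h1]
  have hqx := (eventually_nhds_chartAt hxφ (P := fun u => q (φ.symm u) ∈ χ.source ∧
      ContDiffAt ℝ ∞ Q u)).2 <| by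
    filter_upwards [eventually_contDiffAt_inCharts hq x] with z ⟨h1, h2, h3⟩
    refine ⟨?_, h3⟩
    rwa [φ.left_inv h1]
  obtain ⟨S, hS, hSo, hxS⟩ := eventually_nhds_iff.1 (hpx.and (hqx.and hξ))
  obtain ⟨U, hUo, hxU, hUS, hU⟩ := exists_curve_of_germ (f := P) (q := Q) (ξ := ξ) (X := X)
    (hpx.mono fun u hu => hu.2.2)
    ((hW.submersion_left.isSubmersionAt x).fderiv_inCharts_surjective hxφ
      (mem_chart_source 𝔽 (p x)))
    (hqx.mono fun u hu => hu.2) (hξ.mono fun u hu => hu.1) (by rwa [hQ x hxφ]) hξx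
    (hξ.mono fun u hu k => (hu.2 k).1) (hξ.mono fun u hu k => (hu.2 k).2) (hSo.mem_nhds hxS)
  refine ⟨φ.source ∩ φ ⁻¹' U, φ.isOpen_inter_preimage hUo, ⟨hxφ, hxU⟩, ?_⟩
  rintro w ⟨hwφ, hwU⟩ w' ⟨hwφ', hwU'⟩ h
  obtain ⟨g, rfl, hg⟩ := h.exists_germ
  have hgc : ContinuousAt g w := hg.self_of_nhds.1.continuousAt
  have hgφ : ∀ᶠ z in 𝓝 w, z ∈ φ.source ∧ g z ∈ φ.source :=
    Filter.inter_mem (φ.open_source.mem_nhds hwφ)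
      (hgc.preimage_mem_nhds (φ.open_source.mem_nhds hwφ'))
  have hgval : ∀ z ∈ φ.source, inCharts 𝔼 𝔼 x x g (φ z) = φ (g z) := fun z hz =>
    congrArg (fun a => φ (g a)) (φ.left_inv hz)
  obtain ⟨l, hl, c, hc0, hc1, hc⟩ := hU (φ w) hwU (φ (g w)) hwU' (inCharts 𝔼 𝔼 x x g)
    (hgval w hwφ)
    ((eventually_nhds_chartAt hwφ).2 (by
      filter_upwards [hg, hgφ] with z h1 h2
      exact contDiffAt_inCharts h2.1 h1.1 h2.2))
    ((eventually_nhds_chartAt hwφ).2 (by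
      filter_upwards [hg, hgφ] with z h1 h2
      rw [hgval z h2.1, hP _ h2.1, hP _ h2.2, hQ _ h2.1, hQ _ h2.2, h1.2.1, h1.2.2]
      exact ⟨rfl, rfl⟩))
  have hqw : q w ∈ χ.source := by
    have := (hS _ (hUS hwU)).2.1.1
    rwa [φ.left_inv hwφ] at this
  -- The parameter must depend on `q z` alone, so that it is constant along the orbit and still
  -- annihilated by `X` at all nearby points of `N`.
  obtain ⟨μ, hμw, hμ⟩ := hW.submersion_right.exists_descent hwφ hqw
    (B := fun y k => X y k = 0) hl
  obtain ⟨O, hO, hOo, hwO⟩ := eventually_nhds_iff.1 hμ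
  -- No closeness to `w` is required inside a fibre of `q`, only that `q z` be near `q w`. So `U'`
  -- contains the entire orbit.
  let U' : Opens W := ⟨(φ.source ∩ φ ⁻¹' S) ∩ q ⁻¹' (χ.source ∩ χ ⁻¹' O),
    (φ.isOpen_inter_preimage hSo).inter ((χ.isOpen_inter_preimage hOo).preimage hq.continuous)⟩
  let ζ : 𝔼 → 𝔼 := fun u => ξ u (μ (Q u))
  have hUp : ∀ z ∈ U', p z ∈ ψ.source := fun z hz => by
    have := (hS _ hz.1.2).1.2.1
    rwa [φ.left_inv hz.1.1] at this
  have hζ : ∀ z ∈ U', FieldSmoothAt 𝔼 (fieldOfChart 𝔼 x ζ) z := fun z hz => by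
    refine contMDiffAt_fieldOfChart hz.1.1 ((hS _ hz.1.2).2.2.1.clm_apply
      (ContDiffAt.comp (g := μ) _ ?_ (hS _ hz.1.2).2.1.2))
    rw [hQ z hz.1.1]
    exact (hO _ hz.2.2).1
  have hγφ : ∀ t ∈ Set.Icc (0 : ℝ) 1, φ (φ.symm (c t)) = c t := fun t ht =>
    φ.right_inv (hS _ (hc t ht).1).1.1
  refine ⟨U', fieldOfChart 𝔼 x ζ, fun t => φ.symm (c t), 1,
    ⟨⟨fun z hz => (hζ z hz).contMDiffWithinAt, ?_⟩,
      ⟨fun z hz => (hζ z hz).contMDiffWithinAt, ?_⟩⟩, zero_le_one, ?_, ?_, ?_, ?_⟩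
  · intro z hz
    refine chartDeriv_injective (hUp z hz) ?_
    exact (fderiv_inCharts hz.1.1 hp.contMDiffAt (hUp z hz) _).symm.trans
      ((congrArg _ (chartDeriv_fieldOfChart hz.1.1 ζ)).trans
        (((hS _ hz.1.2).2.2.2 _).1.trans (map_zero _).symm))
  · intro z hz
    refine chartDeriv_injective hz.2.1 ?_
    have h1 : X (Q (φ z)) (μ (Q (φ z))) = 0 := by
      rw [hQ z hz.1.1]
      exact (hO _ hz.2.2).2
    exact (fderiv_inCharts hz.1.1 hq.contMDiffAt hz.2.1 _).symm.trans
      ((congrArg _ (chartDeriv_fieldOfChart hz.1.1 ζ)).trans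
        (((hS _ hz.1.2).2.2.2 _).2.trans (h1.trans (map_zero _).symm)))
  · simp only [hc0, φ.left_inv hwφ]
  · simp only [hc1, φ.left_inv hwφ']
  · intro t ht
    obtain ⟨h1, -, h2⟩ := hc t ht
    refine ⟨⟨φ.map_target (hS _ h1).1.1, ?_⟩, (hS _ h1).2.1.1, ?_⟩
    · rw [Set.mem_preimage, hγφ t ht]
      exact h1
    · have h3 : χ (q (φ.symm (c t))) = χ (q w) := h2.trans (hQ w hwφ)
      rw [Set.mem_preimage, h3]
      exact hwO
  · intro t ht
    obtain ⟨h1, h2, h3⟩ := hc t ht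
    -- Along the orbit `Q` keeps its value at `φ w`, where `μ` equals `l (φ w)`. The orbit is
    -- therefore an integral curve of the bi-vertical field.
    have h4 : ξ (c t) (l (φ w)) = ζ (c t) := by
      simp only [ζ]
      rw [h3, hQ w hwφ, hμw]
    have h5 : chartSymmDeriv 𝔼 x (c t) (ξ (c t) (l (φ w))) =
        fieldOfChart 𝔼 x ζ (φ.symm (c t)) := by
      rw [h4]
      exact congrArg (fun u => chartSymmDeriv 𝔼 x u (ζ u)) (hγφ t ht).symm
    have h6 := hasMFDerivAt_chartAt_symm_comp h2 (hS _ h1).1.1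
    rw [h5] at h6
    exact h6.hasMFDerivWithinAt

end Leaves

/-! ### The theorem for disjoint unions -/

/-- The manifold carrying the bi-submersion is the disjoint union `Σ i, W i` of countably many
manifolds, the piece `W i` being of dimension `d i`: it need not be connected, and its connected
components need not all have the same dimension. Since all sheaves and maps on a disjoint union
are given piece by piece, so are the bi-submersion and its bi-vertical vector fields. -/
theorem mainTheorem4
    {m n : ℕ}
    {M : Type*} [TopologicalSpace M] [ChartedSpace (EuclideanSpace ℝ (Fin m)) M]
    [IsManifold (𝓡 m) ∞ M] [T2Space M] [SecondCountableTopology M]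
    {N : Type*} [TopologicalSpace N] [ChartedSpace (EuclideanSpace ℝ (Fin n)) N]
    [IsManifold (𝓡 n) ∞ N] [T2Space N] [SecondCountableTopology N]
    {ι : Type*} [Countable ι] {d : ι → ℕ}
    {W : ι → Type u} [∀ i, TopologicalSpace (W i)]
    [∀ i, ChartedSpace (EuclideanSpace ℝ (Fin (d i))) (W i)]
    [∀ i, IsManifold (𝓡 (d i)) ∞ (W i)] [∀ i, T2Space (W i)]
    [∀ i, SecondCountableTopology (W i)]
    (FM : Opens M → Set (VField m M)) (hFM : IsSingularFoliation FM)
    (FN : Opens N → Set (VField n N)) (hFN : IsSingularFoliation FN)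
    (p : (i : ι) → W i → M) (q : (i : ι) → W i → N)
    (hW : ∀ i, IsBiSubmersion (d := d i) FM FN (p i) (q i))
    (hBV : ∀ i, IsSingularFoliation (biVerticalFields (d := d i) (m := m) (n := n) (p i) (q i)))
    (x : Σ i, W i) :
    ∃ U : Set (Σ i, W i), IsOpen U ∧ x ∈ U ∧ ∀ w ∈ U, ∀ w' ∈ U,
      (EquivalentPoints (d := d w.1) (d' := d w'.1)
          (p w.1) (q w.1) (p w'.1) (q w'.1) w.2 w'.2 ↔
        ∃ (i : ι) (a b : W i), w = ⟨i, a⟩ ∧ w' = ⟨i, b⟩ ∧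
          SameLeaf (biVerticalFields (d := d i) (m := m) (n := n) (p i) (q i)) a b) := by
  obtain ⟨i, x⟩ := x
  obtain ⟨U, hUo, hxU, hU⟩ := (hW i).exists_nhds_leafStep hFN.toIsVFieldSubsheaf x
  refine ⟨Sigma.mk i '' U, isOpenMap_sigmaMk U hUo, ⟨x, hxU, rfl⟩, ?_⟩
  rintro _ ⟨w, hw, rfl⟩ _ ⟨w', hw', rfl⟩
  constructor
  · intro h
    exact ⟨i, w, w', rfl, rfl, Relation.EqvGen.rel _ _ (hU w hw w' hw' h)⟩
  · rintro ⟨j, a, b, ha, hb, h⟩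
    cases ha
    cases hb
    exact (locallyRelated_of_sameLeaf (hW _).submersion_left.contMDiff
      (hW _).submersion_right.contMDiff h).equivalentPoints
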